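/- **Conventions.** $\mathbb N=\{1,2,\dots\}$. $\mathcal X$ is a topological space with a Radon measure $\mu$ of full support; for an open interval $I\subset(0,\infty)$, $\mathcal P_I(\mu)$ is the set of $p\in L^1(\mu)$ with $p\in I$ $\mu$-a.e. and $\int p\,d\mu=1$, and $\mathcal P(\mu)=\mathcal P_{(0,\infty)}(\mu)$. Manifolds are smooth, Hausdorff, second countable and connected. For a set of densities, $e_x(p):=p(x)$. A manifold $\mathcal M\subset\mathcal P(\mu)$ is a *statistical model* if there is a $\mu$-null set $\mathcal N$ such that: the topology of $\mathcal M$ is induced by $(e_x)_{x\notin\mathcal N}$; $e_x$ is smooth on $\mathcal M$ for $x\notin\mathcal N$; the derivatives of $e_x$ of any order at a point of $\mathcal M$ are Borel in $x\notin\mathcal N$; for a smooth vector field $V$ and $p\in\mathcal M$, $V_p(e_x)=0$ for all $x\notin\mathcal N$ iff $V_p=0$; and for smooth vector fields $V,W$ and $p\in\mathcal M$ the functions $x\mapsto V_p(e_x)$, $x\mapsto V_p(We_x)$ are in $L^1(\mu)$ with integral $0$. Let $\tau$ be smooth on $I$ with $\tau'>0$ and $h$ smooth on $\tau(I)$ with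 $h''>0$, and put $\ell=h'\circ\tau$. The function $\exp_{h,\tau}\colon\mathbb R\to[0,\infty]$ is $\ell^{-1}$ on $\ell(I)$, $\infty$ on $[\sup\ell(I),\infty)$ and $0$ on $(-\infty,\inf\ell(I)]$. For an $n$-dimensional manifold $\mathcal M\subset\mathcal P_I(\mu)$, an *$(h,\tau)$-exponential coordinate representation* is a tuple $(U,\theta,T,c,\psi)$ with a coordinate system $(U,\theta)$ of $\mathcal M$, continuous $T\colon\mathcal X\to\mathbb R^n$ and $c\colon\mathcal X\to\mathbb R$, and smooth $\psi\colon U\to\mathbb R$, such that $p(x)=\exp_{h,\tau}(\langle\theta(p),T(x)\rangle-c(x)-\psi(p))$ for all $p\in U$, $x\in\mathcal X$; it is *global* if $U=\mathcal M$. An *$(h,\tau)$-exponential family* is a statistical model in $\mathcal P_I(\mu)$ each of whose points lies in such a $U$. An $(h,\tau)$-exponential family $\mathcal M$ is *identically repeatable* if it has a *repetition*, that is, injections $\iota_k\colon\mathcal M\to\mathcal P_I(\mu^{\otimes k})$, $k\in\mathbb N$, such that: $\iota_k(\mathcal M)$ is a statistical model in $\mathcal P(\mu^{\otimes k})$; there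 are a positive, strictly increasing smooth function $\alpha_k$ on $I$ and a positive smooth function $b_k$ on $\mathcal M$ such that for each global representation $(\mathcal M,\theta,T,c,\psi)$ there is $\psi_k\in C^\infty(\mathcal M)$ with $$\iota_k(p)(\boldsymbol x)=\alpha_k\Big(\exp_{h,\tau}\Big(b_k(p)\sum_{m=1}^k\big(\langle\theta(p),T(x_m)\rangle-c(x_m)\big)-\psi_k(p)\Big)\Big)\qquad(p\in\mathcal M,\ \boldsymbol x\in\mathcal X^k),$$ where the value of $\exp_{h,\tau}$ lies in $I$; and $\int_{\mathcal X^{k'}}\iota_{k+k'}(p)(\boldsymbol x,\boldsymbol y)\,d\mu^{\otimes k'}(\boldsymbol y)=\iota_k(p)(\boldsymbol x)$ for all $k,k'\in\mathbb N$, $p\in\mathcal M$, $\boldsymbol x\in\mathcal X^k$. Random variables $(X_k)_{k\in\mathbb N}$ on a probability space $(\Omega,\mathbb P)$ are *$(h,\tau)$-dependent and identically distributed according to $p\in\mathcal M$* (with respect to $(\iota_k)$) if $(X_1,\dots,X_k)$ has law $\iota_k(p)\,\mu^{\otimes k}$ for every $k\in\mathbb N$. **Theorem.** Let $d\in\mathbb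 N$ and $q>1$ with $d(q-1)<2$. Let $\mathcal X=\mathbb R^d$ with Lebesgue measure, $I=(0,\infty)$ and $h_q(r)=\int_1^r\frac{t^{1-q}-1}{1-q}\,dt$ for $r>0$. For $v\in\mathbb R^d$ let $$p^v(x)=\left[(q-1)|x-v|^2+\left(\Big(\frac{q-1}{\pi}\Big)^{\frac d2}\frac{\Gamma(\frac1{q-1})}{\Gamma(\frac1{q-1}-\frac d2)}\right)^{\frac{2(1-q)}{2-d(q-1)}}\right]^{\frac1{1-q}},\qquad x\in\mathbb R^d .$$ 1. The set $\mathcal M=\{p^v\mid v\in\mathbb R^d\}$, with a suitable structure of a $d$-dimensional manifold, is an $(h_q,\mathrm{id})$-exponential family that has a global $(h_q,\mathrm{id})$-exponential coordinate representation. It is identically repeatable; moreover, it has a repetition $(\iota_k)$ such that $\int_{\mathbb R^d}|T(x)|\,\iota_1(p)(x)\,dx<\infty$ for every $p\in\mathcal M$ and every global representation $(\mathcal M,\theta,T,c,\psi)$. 2. (Strong law of large numbers.) Let $(\iota_k)$ be any repetition of $\mathcal M$, $(\mathcal M,\theta,T,c,\psi)$ any global $(h_q,\mathrm{id})$-exponential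 coordinate representation and $p\in\mathcal M$, with $\int_{\mathbb R^d}|T(x)|\,\iota_1(p)(x)\,dx<\infty$. If $(X_k)_{k\in\mathbb N}$ are $(h_q,\mathrm{id})$-dependent and identically distributed according to $p$, then $$\frac1k\sum_{m=1}^kT(X_m)\xrightarrow{k\to\infty}\int_{\mathbb R^d}T(x)\,\iota_1(p)(x)\,dx\qquad\mathbb P\text{-a.s.}$$ -/

import Mathlib

open MeasureTheory Filter Topology
open scoped ContDiff Manifold

noncomputable section

namespace DeformedExp

/-! ### Gauges and deformed exponential functions -/

/-- `(h, τ, I)` belongs to the class `𝒢`: `I ⊆ (0, ∞)` is a (nonempty) open interval,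
`τ` is smooth on `I` with `τ' > 0`, and `h` is smooth on `τ(I)` with `h'' > 0`. -/
structure IsGauge (h τ : ℝ → ℝ) (I : Set ℝ) : Prop where
  isOpen : IsOpen I
  ordConnected : I.OrdConnected
  nonempty : I.Nonempty
  subset_pos : I ⊆ Set.Ioi 0
  smooth_tau : ContDiffOn ℝ ∞ τ I
  deriv_tau_pos : ∀ t ∈ I, 0 < deriv τ t
  smooth_h : ContDiffOn ℝ ∞ h (τ '' I)
  deriv_two_h_pos : ∀ r ∈ τ '' I, 0 < deriv (deriv h) r

/-- `ℓ_{h,τ} = h' ∘ τ`. -/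
def ell (h τ : ℝ → ℝ) (t : ℝ) : ℝ := deriv h (τ t)

open Classical in
/-- The `(h, τ)`-exponential function `ℝ → [0, ∞]`: the inverse of `ℓ_{h,τ} : I → ℓ_{h,τ}(I)`,
extended by `∞` on `[sup ℓ_{h,τ}(I), ∞)` and by `0` on `(-∞, inf ℓ_{h,τ}(I)]`. -/
def deformedExp (h τ : ℝ → ℝ) (I : Set ℝ) (u : ℝ) : EReal :=
  if sSup ((fun t => (ell h τ t : EReal)) '' I) ≤ (u : EReal) then ⊤
  else if (u : EReal) ≤ sInf ((fun t => (ell h τ t : EReal)) '' I) then 0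
  else ((Function.invFunOn (ell h τ) I u : ℝ) : EReal)

/-! ### Statistical models -/

/-- `p` is a probability density with respect to `μ` with values in `I` almost everywhere,
i.e. a representative of an element of `𝒫_I(μ)`. -/
structure IsDensity {X : Type*} [MeasurableSpace X] (μ : Measure X) (I : Set ℝ)
    (p : X → ℝ) : Prop where
  integrable : Integrable p μ
  mem : ∀ᵐ x ∂μ, p x ∈ I
  integral_eq_one : ∫ x, p x ∂μ = 1

/-- The function `V f : p ↦ V_p(f)` for a vector field `V` and a function `f` on a manifold. -/
def vderiv {M : Type*} {n : ℕ} [TopologicalSpace M] [ChartedSpace (EuclideanSpace ℝ (Fin n)) M]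
    (V : ∀ p : M, TangentSpace (𝓡 n) p) (f : M → ℝ) : M → ℝ :=
  fun p => (mfderiv (𝓡 n) 𝓘(ℝ, ℝ) f p (V p) : ℝ)

/-- `V` is a smooth vector field. -/
def IsSmoothField {M : Type*} {n : ℕ} [TopologicalSpace M]
    [ChartedSpace (EuclideanSpace ℝ (Fin n)) M] [IsManifold (𝓡 n) ∞ M]
    (V : ∀ p : M, TangentSpace (𝓡 n) p) : Prop :=
  ContMDiff (𝓡 n) (𝓡 n).tangent ∞ (fun p => (⟨p, V p⟩ : TangentBundle (𝓡 n) M))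

/-- The `n`-dimensional manifold `M` of densities is a statistical model in `𝒫(μ)`. The map `e`
sends a point `p` of `M` to the density that it is, so `fun p => e p x` is the evaluation
function at `x`. A manifold is Hausdorff, second countable and connected. -/
structure IsStatisticalModel {X : Type*} [MeasurableSpace X] (μ : Measure X)
    {M : Type*} (n : ℕ) [tM : TopologicalSpace M] [ChartedSpace (EuclideanSpace ℝ (Fin n)) M]
    [IsManifold (𝓡 n) ∞ M] (e : M → X → ℝ) : Prop where
  t2 : T2Space M
  secondCountable : SecondCountableTopology M
  connected : ConnectedSpace M
  density : ∀ p, IsDensity μ (Set.Ioi 0) (e p)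
  /-- distinct points are distinct elements of `L¹(μ)` -/
  injective : ∀ p p', e p =ᵐ[μ] e p' → p = p'
  exists_null : ∃ N : Set X, μ N = 0 ∧
    -- the topology is the one induced by the evaluation functions
    (tM =
      ⨅ x : ↥Nᶜ, TopologicalSpace.induced (fun p : M => e p x) inferInstance) ∧
    -- the evaluation functions are smooth
    (∀ x ∉ N, ContMDiff (𝓡 n) 𝓘(ℝ, ℝ) ∞ (fun p => e p x)) ∧
    -- their derivatives of any order at a point are Borel in `x`
    (∀ Vs : List (∀ p : M, TangentSpace (𝓡 n) p), (∀ V ∈ Vs, IsSmoothField V) →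
      ∀ p, Measurable (fun x : ↥Nᶜ => Vs.foldr vderiv (fun p' => e p' x) p)) ∧
    -- a tangent vector that annihilates them all vanishes
    (∀ V : (∀ p : M, TangentSpace (𝓡 n) p), IsSmoothField V → ∀ p,
      (∀ x ∉ N, vderiv V (fun p' => e p' x) p = 0) ↔ V p = 0)
  /-- differentiation up to order two commutes with the integration -/
  integral_deriv : ∀ V W : (∀ p : M, TangentSpace (𝓡 n) p), IsSmoothField V → IsSmoothField W →
    ∀ p,
      Integrable (fun x => vderiv V (fun p' => e p' x) p) μ ∧
      Integrable (fun x => vderiv V (vderiv W (fun p' => e p' x)) p) μ ∧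
      ∫ x, vderiv V (fun p' => e p' x) p ∂μ = 0 ∧
      ∫ x, vderiv V (vderiv W (fun p' => e p' x)) p ∂μ = 0

/-- The density that a point of a set of densities is. -/
abbrev densityOf {X : Type*} (S : Set (X → ℝ)) : ↥S → X → ℝ := Subtype.val

/-- The set `S` of densities carries a manifold structure (of some dimension) that makes it a
statistical model. (The conditions determine the topology and the smooth structure.) -/
def IsStatisticalModelSet {X : Type*} [MeasurableSpace X] (μ : Measure X)
    (S : Set (X → ℝ)) : Prop :=
  ∃ (n : ℕ) (_ : TopologicalSpace ↥S) (_ : ChartedSpace (EuclideanSpace ℝ (Fin n)) ↥S)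
    (_ : IsManifold (𝓡 n) ∞ ↥S), IsStatisticalModel μ n (densityOf S)

/-! ### Deformed exponential families -/

/-- `(U, θ, T, c, ψ)`, with `U` the source of the chart `θ`, is an `(h, τ)`-exponential coordinate
representation on the manifold `M` of densities. -/
structure IsExpCoordRep {X : Type*} [TopologicalSpace X] (h τ : ℝ → ℝ) (I : Set ℝ)
    {M : Type*} {n : ℕ} [TopologicalSpace M] [ChartedSpace (EuclideanSpace ℝ (Fin n)) M]
    (e : M → X → ℝ) (θ : OpenPartialHomeomorph M (EuclideanSpace ℝ (Fin n)))
    (T : X → EuclideanSpace ℝ (Fin n)) (c : X → ℝ) (ψ : M → ℝ) : Prop where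
  chart : θ ∈ IsManifold.maximalAtlas (𝓡 n) ∞ M
  continuous_T : Continuous T
  continuous_c : Continuous c
  smooth_psi : ContMDiffOn (𝓡 n) 𝓘(ℝ, ℝ) ∞ ψ θ.source
  eq_exp : ∀ p ∈ θ.source, ∀ x,
    (e p x : EReal) = deformedExp h τ I (inner ℝ (θ p) (T x) - c x - ψ p)

/-- A global coordinate representation `(M, θ, T, c, ψ)`. -/
structure IsGlobalExpCoordRep {X : Type*} [TopologicalSpace X] (h τ : ℝ → ℝ) (I : Set ℝ)
    {M : Type*} {n : ℕ} [TopologicalSpace M] [ChartedSpace (EuclideanSpace ℝ (Fin n)) M]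
    (e : M → X → ℝ) (θ : OpenPartialHomeomorph M (EuclideanSpace ℝ (Fin n)))
    (T : X → EuclideanSpace ℝ (Fin n)) (c : X → ℝ) (ψ : M → ℝ) : Prop
    extends IsExpCoordRep h τ I e θ T c ψ where
  source_eq : θ.source = Set.univ

/-- The manifold `M` of densities is an `(h, τ)`-exponential family in `𝒫_I(μ)`. -/
structure IsExpFamily {X : Type*} [TopologicalSpace X] [MeasurableSpace X]
    (h τ : ℝ → ℝ) (I : Set ℝ) (μ : Measure X)
    {M : Type*} (n : ℕ) [TopologicalSpace M] [ChartedSpace (EuclideanSpace ℝ (Fin n)) M]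
    [IsManifold (𝓡 n) ∞ M] (e : M → X → ℝ) : Prop where
  gauge : IsGauge h τ I
  density : ∀ p, IsDensity μ I (e p)
  model : IsStatisticalModel μ n e
  exists_rep : ∀ p : M, ∃ (θ : OpenPartialHomeomorph M (EuclideanSpace ℝ (Fin n)))
    (T : X → EuclideanSpace ℝ (Fin n)) (c : X → ℝ) (ψ : M → ℝ),
    p ∈ θ.source ∧ IsExpCoordRep h τ I e θ T c ψ

/-- The `k`-fold product measure `μ^{⊗k}` on `X^k`. -/
abbrev prodMeasure {X : Type*} [MeasurableSpace X] (μ : Measure X) (k : ℕ) :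
    Measure (Fin k → X) :=
  Measure.pi (fun _ => μ)

/-- `(ι_k)_{k ≥ 1}` is a repetition of the `(h, τ)`-exponential family `M`; the value at `k = 0`
is irrelevant. -/
structure IsRepetition {X : Type*} [TopologicalSpace X] [MeasurableSpace X]
    (h τ : ℝ → ℝ) (I : Set ℝ) (μ : Measure X)
    {M : Type*} {n : ℕ} [TopologicalSpace M] [ChartedSpace (EuclideanSpace ℝ (Fin n)) M]
    (e : M → X → ℝ) (ι : ∀ k : ℕ, M → (Fin k → X) → ℝ) : Prop where
  density : ∀ k, 1 ≤ k → ∀ p, IsDensity (prodMeasure μ k) I (ι k p)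
  injective : ∀ k, 1 ≤ k → Function.Injective (ι k)
  model : ∀ k, 1 ≤ k → IsStatisticalModelSet (prodMeasure μ k) (Set.range (ι k))
  /-- the functions `α_k` on `I`, `b_k` on `M` and `ψ_k` on `M`; the value of the deformed
  exponential function is a number `r ∈ I`, to which `α_k` is applied -/
  formula : ∀ k, 1 ≤ k → ∃ (α : ℝ → ℝ) (b : M → ℝ),
    (∀ r ∈ I, 0 < α r) ∧ StrictMonoOn α I ∧ ContDiffOn ℝ ∞ α I ∧
    (∀ p, 0 < b p) ∧ ContMDiff (𝓡 n) 𝓘(ℝ, ℝ) ∞ b ∧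
    ∀ (θ : OpenPartialHomeomorph M (EuclideanSpace ℝ (Fin n)))
      (T : X → EuclideanSpace ℝ (Fin n)) (c : X → ℝ) (ψ : M → ℝ),
      IsGlobalExpCoordRep h τ I e θ T c ψ →
      ∃ ψk : M → ℝ, ContMDiff (𝓡 n) 𝓘(ℝ, ℝ) ∞ ψk ∧
        ∀ (p : M) (x : Fin k → X), ∃ r ∈ I,
          (r : EReal) =
            deformedExp h τ I (b p * ∑ m, (inner ℝ (θ p) (T (x m)) - c (x m)) - ψk p) ∧
          ι k p x = α r
  marginal : ∀ k k', 1 ≤ k → 1 ≤ k' → ∀ (p : M) (x : Fin k → X),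
    ∫ y : Fin k' → X, ι (k + k') p (Fin.append x y) ∂(prodMeasure μ k') = ι k p x

/-- The random variables `Y 0, Y 1, …` (that is `X₁, X₂, …`) are `(h, τ)`-dependent and identically
distributed according to `p`, for the repetition `ι`: the law of the first `k` of them has density
`ι_k(p)` with respect to `μ^{⊗k}`, for every `k ≥ 1`. -/
structure IsDependentIdent {X : Type*} [MeasurableSpace X] (μ : Measure X) {M : Type*}
    (ι : ∀ k : ℕ, M → (Fin k → X) → ℝ) (p : M)
    {Ω : Type*} [MeasurableSpace Ω] (P : Measure Ω) (Y : ℕ → Ω → X) : Prop where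
  measurable : ∀ m, Measurable (Y m)
  law : ∀ k, 1 ≤ k → P.map (fun w (m : Fin k) => Y m w) =
    (prodMeasure μ k).withDensity (fun x => ENNReal.ofReal (ι k p x))

/-! ### `q`-Gaussians -/

/-- `h_q(r) = ∫_1^r (t^{1-q} - 1) / (1 - q) dt`. -/
def hq (q : ℝ) (r : ℝ) : ℝ := ∫ t in (1 : ℝ)..r, (t ^ (1 - q) - 1) / (1 - q)

/-- The additive constant that normalizes the `q`-Gaussians on `ℝ^d`. -/
def qGaussianConst (q : ℝ) (d : ℕ) : ℝ :=
  (((q - 1) / Real.pi) ^ ((d : ℝ) / 2) * Real.Gamma (1 / (q - 1)) /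
    Real.Gamma (1 / (q - 1) - (d : ℝ) / 2)) ^ (2 * (1 - q) / (2 - d * (q - 1)))

/-- The `q`-Gaussian density `p^v` on `ℝ^d`. -/
def qGaussian (q : ℝ) (d : ℕ) (v x : EuclideanSpace ℝ (Fin d)) : ℝ :=
  ((q - 1) * ‖x - v‖ ^ 2 + qGaussianConst q d) ^ (1 / (1 - q))

/-- The set `{p^v | v ∈ ℝ^d}` of densities. -/
def qGaussianFamily (q : ℝ) (d : ℕ) : Set (EuclideanSpace ℝ (Fin d) → ℝ) :=
  {p | ∃ v, p = qGaussian q d v}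

end DeformedExp

end

open DeformedExp

namespace DeformedExp

/-! ### The `q`-logarithm and the `q`-exponential function -/

/-! For `h_q` the function `ℓ` is the `q`-logarithm `(r^(1-q) - 1)/(1-q)`, and it turns `p^v` into a
quadratic: `ℓ(p^v(x)) = -|x-v|² - const` (`ell_qGaussian`). Expanding the square gives a global
representation with `θ(p^v) = v` and `T(x) = 2x`. Conversely, in any global representation `⟨θ(p),
T(x)⟩ - c(x)` equals `-|x-v|²` up to a term depending only on `p`. Subtracting this identity at two
points of the chart cancels both `c(x)` and `|x|²`, so `T` is affine
(`IsGlobalExpCoordRep.exists_inner_eq`).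

The repetition consists of Student densities proportional to `(C + (q-1) ∑ |x_m - v|²)^(-(2 +
dk/2))`. Each is an increasing power of a `q`-exponential of a sum over `m`, and integrating out one
copy of `ℝ^d` lowers the exponent by `d/2`, so the densities are consistent
(`integral_studentDensity_append`). The integrals reduce to Gaussian ones by writing a negative
power as a Gamma integral.

The `q`-Gaussians and the Student densities are both translates of some `K (C + B(y,y))^(-s)` along
a linear map `J`, which is the identity or the diagonal embedding; a bilinear form `B` is used
because `(ℝ^d)^k` carries the supremum norm. `isStatisticalModel_radial` treats both at once:
derivatives in `v` are derivatives in `x`, they are dominated by the density, and their integrals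
vanish.

For the strong law, the density in any repetition depends on `x` only through `∑ |x_m - v|²`. The
joint law is thus invariant under swapping two variables and under reflecting the last one in `v`.
As `T` is affine, the coordinates of `T(X_m) - T(v)` are identically distributed, and their joint
laws do not change with the sign of the last one. This symmetry replaces independence: odd
truncations are martingale differences, and Kolmogorov's proof applies (`strong_law_of_reflection`).
By the same reflection the mean is `T(v)`. -/

theorem hasDerivAt_hq {q r : ℝ} (hr : 0 < r) :
    HasDerivAt (hq q) ((r ^ (1 - q) - 1) / (1 - q)) r := by
  have hc : ContinuousOn (fun t : ℝ => (t ^ (1 - q) - 1) / (1 - q)) (Set.Ioi 0) := by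
    refine ContinuousOn.div_const (ContinuousOn.sub ?_ continuousOn_const) _
    exact fun t ht => (Real.continuousAt_rpow_const t _ (Or.inl (ne_of_gt ht))).continuousWithinAt
  refine intervalIntegral.integral_hasDerivAt_right ?_ ?_ ?_
  · refine (hc.mono fun t ht => ?_).intervalIntegrable
    exact lt_of_lt_of_le (lt_min one_pos hr) ht.1
  · exact ContinuousOn.stronglyMeasurableAtFilter isOpen_Ioi hc r hr
  · exact hc.continuousAt (Ioi_mem_nhds hr)

theorem ell_hq {q r : ℝ} (hr : 0 < r) : ell (hq q) id r = (r ^ (1 - q) - 1) / (1 - q) :=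
  (hasDerivAt_hq hr).deriv

theorem hasDerivAt_deriv_hq {q r : ℝ} (hq1 : q ≠ 1) (hr : 0 < r) :
    HasDerivAt (deriv (hq q)) (r ^ (-q)) r := by
  have h1 : HasDerivAt (fun t : ℝ => (t ^ (1 - q) - 1) / (1 - q)) (r ^ (-q)) r := by
    have := ((Real.hasDerivAt_rpow_const (p := 1 - q) (Or.inl hr.ne')).sub_const 1).div_const (1 - q)
    have h : 1 - q ≠ 0 := sub_ne_zero.2 hq1.symm
    rwa [show (1 - q - 1) = -q by ring, mul_div_cancel_left₀ _ h] at this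
  refine h1.congr_of_eventuallyEq ?_
  filter_upwards [Ioi_mem_nhds hr] with t ht
  exact (hasDerivAt_hq ht).deriv

theorem contDiffOn_rpow_Ioi (s : ℝ) : ContDiffOn ℝ ∞ (fun r : ℝ => r ^ s) (Set.Ioi 0) :=
  fun _ hr => (Real.contDiffAt_rpow_const_of_ne (ne_of_gt hr)).contDiffWithinAt

theorem isGauge_hq {q : ℝ} (hq1 : q ≠ 1) : IsGauge (hq q) id (Set.Ioi 0) where
  isOpen := isOpen_Ioi
  ordConnected := Set.ordConnected_Ioi
  nonempty := Set.nonempty_Ioi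
  subset_pos := subset_rfl
  smooth_tau := contDiff_id.contDiffOn
  deriv_tau_pos t _ := by simp
  smooth_h := by
    rw [Set.image_id, contDiffOn_infty_iff_deriv_of_isOpen isOpen_Ioi]
    refine ⟨fun r hr => (hasDerivAt_hq hr).differentiableAt.differentiableWithinAt, ?_⟩
    refine ContDiffOn.congr ?_ (fun r hr => (hasDerivAt_hq hr).deriv)
    exact ((contDiffOn_rpow_Ioi _).sub contDiffOn_const).div_const _
  deriv_two_h_pos r hr := by
    rw [Set.image_id] at hr
    rw [(hasDerivAt_deriv_hq hq1 hr).deriv]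
    exact Real.rpow_pos_of_pos hr _

theorem ell_hq_rpow {q z : ℝ} (hq1 : q ≠ 1) (hz : 0 < z) :
    ell (hq q) id (z ^ (1 / (1 - q))) = (z - 1) / (1 - q) := by
  have h : 1 - q ≠ 0 := sub_ne_zero.2 hq1.symm
  rw [ell_hq (Real.rpow_pos_of_pos hz _), ← Real.rpow_mul hz.le, one_div_mul_cancel h,
    Real.rpow_one]

theorem ell_hq_strictMonoOn {q : ℝ} (hq1 : q ≠ 1) :
    StrictMonoOn (ell (hq q) id) (Set.Ioi 0) := by
  refine strictMonoOn_of_deriv_pos (convex_Ioi 0) ?_ fun r hr => ?_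
  · exact fun r hr => (hasDerivAt_deriv_hq hq1 hr).continuousAt.continuousWithinAt
  · rw [interior_Ioi] at hr
    have : deriv (ell (hq q) id) r = r ^ (-q) := (hasDerivAt_deriv_hq hq1 hr).deriv
    rw [this]
    exact Real.rpow_pos_of_pos hr _

theorem deformedExp_ell {q r : ℝ} (hq1 : q ≠ 1) (hr : 0 < r) :
    deformedExp (hq q) id (Set.Ioi 0) (ell (hq q) id r) = r := by
  have hmono := ell_hq_strictMonoOn hq1
  -- The supremum and the infimum of `ℓ` are not attained on the open half-line: `r + 1` and `r / 2`
  -- are witnesses that `ℓ(r)` lies strictly between them.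
  have h1 : ¬ sSup ((fun t => (ell (hq q) id t : EReal)) '' Set.Ioi 0) ≤
      (ell (hq q) id r : EReal) := by
    rw [not_le]
    refine lt_of_lt_of_le ?_ (le_sSup ⟨r + 1, (by positivity : (0 : ℝ) < r + 1), rfl⟩)
    exact EReal.coe_lt_coe_iff.2 (hmono hr (by positivity : (0 : ℝ) < r + 1) (by linarith))
  have h2 : ¬ (ell (hq q) id r : EReal) ≤
      sInf ((fun t => (ell (hq q) id t : EReal)) '' Set.Ioi 0) := by
    rw [not_le]
    refine lt_of_le_of_lt (sInf_le ⟨r / 2, (by positivity : (0 : ℝ) < r / 2), rfl⟩) ?_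
    exact EReal.coe_lt_coe_iff.2 (hmono (by positivity : (0 : ℝ) < r / 2) hr (by linarith))
  rw [deformedExp, if_neg h1, if_neg h2, hmono.injOn.leftInvOn_invFunOn hr]

/-- For `q > 1` the range of `ℓ` is `(-∞, 1/(q-1))`, so a finite value excludes the upper branch,
and any remaining `u` is the `q`-logarithm of `(1 + (1-q)u)^(1/(1-q))`. -/
theorem eq_ell_of_deformedExp_eq {q r u : ℝ} (hq1 : 1 < q)
    (h : deformedExp (hq q) id (Set.Ioi 0) u = r) : u = ell (hq q) id r := by
  have hu : u < 1 / (q - 1) := by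
    by_contra hu
    rw [deformedExp, if_pos] at h
    · exact EReal.top_ne_coe _ h
    · refine sSup_le ?_
      rintro _ ⟨t, ht, rfl⟩
      refine EReal.coe_le_coe_iff.2 (le_trans ?_ (not_lt.1 hu))
      rw [ell_hq ht, ← neg_div_neg_eq, neg_sub, neg_sub]
      have : (0 : ℝ) < t ^ (1 - q) := Real.rpow_pos_of_pos ht _
      exact div_le_div_of_nonneg_right (by linarith) (by linarith)
  have hz : 0 < 1 + (1 - q) * u := by
    rw [lt_div_iff₀ (by linarith)] at hu
    linarith
  have hu' : ell (hq q) id ((1 + (1 - q) * u) ^ (1 / (1 - q))) = u := by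
    rw [ell_hq_rpow hq1.ne' hz]
    have : 1 - q ≠ 0 := by linarith
    field_simp
    ring
  rw [← hu', deformedExp_ell hq1.ne' (Real.rpow_pos_of_pos hz _)] at h
  rw [← EReal.coe_injective h, hu']

/-! ### Manifolds with a single global chart -/

section GlobalChart

variable {n : ℕ} {M : Type*} [TopologicalSpace M] [ChartedSpace (EuclideanSpace ℝ (Fin n)) M]
  {φ : M ≃ₜ EuclideanSpace ℝ (Fin n)}

/-- A vector field, read in the global chart `φ`. -/
def fieldCoord (φ : M ≃ₜ EuclideanSpace ℝ (Fin n)) (V : ∀ p : M, TangentSpace (𝓡 n) p) :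
    EuclideanSpace ℝ (Fin n) → EuclideanSpace ℝ (Fin n) :=
  fun v => V (φ.symm v)

theorem fieldCoord_apply (V : ∀ p : M, TangentSpace (𝓡 n) p) (p : M) :
    fieldCoord φ V (φ p) = V p := by
  have h : ∀ p', p' = p → (V p' : EuclideanSpace ℝ (Fin n)) = V p := by
    rintro _ rfl
    rfl
  exact h _ (φ.symm_apply_apply p)

theorem vderiv_eq_fderiv (hφ : ∀ p : M, chartAt (EuclideanSpace ℝ (Fin n)) p = φ.toOpenPartialHomeomorph)
    (V : ∀ p : M, TangentSpace (𝓡 n) p) {f : M → ℝ}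
    (hf : Differentiable ℝ (fun v => f (φ.symm v))) (p : M) :
    vderiv V f p = fderiv ℝ (fun v => f (φ.symm v)) (φ p) (fieldCoord φ V (φ p)) := by
  rw [fieldCoord_apply]
  have hmd : MDifferentiableAt (𝓡 n) 𝓘(ℝ, ℝ) f p := by
    rw [mdifferentiableAt_iff]
    refine ⟨?_, ?_⟩
    · have : f = (fun v => f (φ.symm v)) ∘ φ := by ext; simp
      rw [this]
      exact (hf.continuous.comp φ.continuous).continuousAt
    · have := (hf (φ p)).differentiableWithinAt (s := Set.range (𝓡 n))
      simpa [writtenInExtChartAt, extChartAt, hφ, chartAt_self_eq, Function.comp_def] using this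
  rw [vderiv, hmd.mfderiv]
  simp [writtenInExtChartAt, extChartAt, hφ, chartAt_self_eq, Function.comp_def]
  rfl

theorem contDiff_fieldCoord [IsManifold (𝓡 n) ∞ M]
    (hφ : ∀ p : M, chartAt (EuclideanSpace ℝ (Fin n)) p = φ.toOpenPartialHomeomorph)
    {V : ∀ p : M, TangentSpace (𝓡 n) p} (hV : IsSmoothField V) :
    ContDiff ℝ ∞ (fieldCoord φ V) := by
  rw [contDiff_iff_contDiffAt]
  intro v
  have h := (Bundle.contMDiffAt_section (φ.symm v)).1 (hV (φ.symm v))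
  rw [contMDiffAt_iff] at h
  have h2 := h.2
  -- All charts coincide, so the coordinate changes of the tangent bundle are the identity and the
  -- trivialization returns `V` itself.
  have key : ∀ y : M, fderivWithin ℝ (((chartAt (EuclideanSpace ℝ (Fin n)) (φ.symm v)).extend (𝓡 n)) ∘
      ((chartAt (EuclideanSpace ℝ (Fin n)) y).extend (𝓡 n)).symm) (Set.range (𝓡 n))
        ((chartAt (EuclideanSpace ℝ (Fin n)) y).extend (𝓡 n) y) =
      ContinuousLinearMap.id ℝ (EuclideanSpace ℝ (Fin n)) := by
    intro y
    have : ((chartAt (EuclideanSpace ℝ (Fin n)) (φ.symm v)).extend (𝓡 n)) ∘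
      ((chartAt (EuclideanSpace ℝ (Fin n)) y).extend (𝓡 n)).symm = id := by
      ext1 z
      simp [hφ]
    rw [this]
    exact fderivWithin_id (by simp)
  simp only [TangentBundle.trivializationAt_apply, key] at h2
  simp only [extChartAt, hφ, chartAt_self_eq] at h2
  simp only [Function.comp_def, modelWithCornersSelf_coe, Set.range_id, contDiffWithinAt_univ,
    OpenPartialHomeomorph.extend_coe] at h2
  have h3 : φ (φ.symm v) = v := φ.apply_symm_apply v
  rw [← h3]
  exact h2

theorem contMDiff_of_contDiff [IsManifold (𝓡 n) ∞ M]
    (hφ : ∀ p : M, chartAt (EuclideanSpace ℝ (Fin n)) p = φ.toOpenPartialHomeomorph) {f : M → ℝ}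
    (hf : ContDiff ℝ ∞ (fun v => f (φ.symm v))) : ContMDiff (𝓡 n) 𝓘(ℝ, ℝ) ∞ f := by
  intro p
  rw [contMDiffAt_iff]
  refine ⟨?_, ?_⟩
  · have : f = (fun v => f (φ.symm v)) ∘ φ := by ext; simp
    rw [this]
    exact (hf.continuous.comp φ.continuous).continuousAt
  · have := (hf.contDiffAt (x := φ p)).contDiffWithinAt (s := Set.range (𝓡 n))
    simpa [extChartAt, hφ, chartAt_self_eq, Function.comp_def] using this

end GlobalChart

/-! ### The integral of a negative power of a quadratic form -/

theorem lintegral_ofReal_eq_of_integral_eq {α : Type*} [MeasurableSpace α] {μ : Measure α}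
    {f : α → ℝ} {a : ℝ} (h0 : ∀ᵐ x ∂μ, 0 ≤ f x) (h : ∫ x, f x ∂μ = a) (ha : a ≠ 0) :
    ∫⁻ x, ENNReal.ofReal (f x) ∂μ = ENNReal.ofReal a := by
  have hi : Integrable f μ := by
    -- A non-integrable function has integral `0` by convention, so a nonzero value forces
    -- integrability.
    by_contra hi
    exact ha (h ▸ integral_undef hi)
  rw [← ofReal_integral_eq_lintegral_ofReal hi h0, h]

theorem lintegral_rpow_mul_exp_neg_mul {s r : ℝ} (hs : 0 < s) (hr : 0 < r) :
    ∫⁻ t in Set.Ioi (0 : ℝ), ENNReal.ofReal (t ^ (s - 1) * Real.exp (-(r * t))) =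
      ENNReal.ofReal (r ^ (-s) * Real.Gamma s) := by
  have hpos : 0 < r ^ (-s) * Real.Gamma s :=
    mul_pos (Real.rpow_pos_of_pos hr _) (Real.Gamma_pos_of_pos hs)
  refine lintegral_ofReal_eq_of_integral_eq ?_ ?_ hpos.ne'
  · filter_upwards [ae_restrict_mem measurableSet_Ioi] with t ht
    exact mul_nonneg (Real.rpow_nonneg (le_of_lt ht) _) (Real.exp_pos _).le
  · rw [Real.integral_rpow_mul_exp_neg_mul_Ioi hs hr, one_div, Real.inv_rpow hr.le,
      Real.rpow_neg hr.le]

/-- If the Gaussians `exp (-t Q)` have the integrals `G t ^ (-δ)`, then the powers `(A + Q) ^ (-s)`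
with `s > δ` have integrals given by the Gamma function. -/
theorem lintegral_add_rpow_neg {X : Type*} [MeasurableSpace X] {μ : Measure X} [SFinite μ]
    {Q : X → ℝ} (hQm : Measurable Q) (hQ : ∀ x, 0 ≤ Q x) {G δ : ℝ} (hG : 0 ≤ G)
    (hgauss : ∀ t : ℝ, 0 < t →
      ∫⁻ x, ENNReal.ofReal (Real.exp (-(t * Q x))) ∂μ = ENNReal.ofReal (G * t ^ (-δ)))
    {A s : ℝ} (hA : 0 < A) (hs0 : 0 < s) (hs : δ < s) :
    ∫⁻ x, ENNReal.ofReal ((A + Q x) ^ (-s)) ∂μ =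
      ENNReal.ofReal (G * Real.Gamma (s - δ) / Real.Gamma s * A ^ (δ - s)) := by
  have hΓ := Real.Gamma_pos_of_pos hs0
  -- Write `z^(-s)` as `Γ(s)⁻¹ ∫ t^(s-1) exp(-zt) dt` and exchange the integrals by Tonelli. The
  -- inner integral is Gaussian and contributes `t^(-δ)`, which leaves a Gamma integral with
  -- parameter `s - δ`.
  have hrepr : ∀ x, ENNReal.ofReal ((A + Q x) ^ (-s)) = ENNReal.ofReal (Real.Gamma s)⁻¹ *
      ∫⁻ t in Set.Ioi (0 : ℝ), ENNReal.ofReal (t ^ (s - 1) * Real.exp (-((A + Q x) * t))) := by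
    intro x
    have hx : 0 < A + Q x := add_pos_of_pos_of_nonneg hA (hQ x)
    rw [lintegral_rpow_mul_exp_neg_mul hs0 hx, ← ENNReal.ofReal_mul (by positivity)]
    congr 1
    field_simp
  simp_rw [hrepr]
  have hm : Measurable (Function.uncurry fun (x : X) (t : ℝ) =>
      ENNReal.ofReal (t ^ (s - 1) * Real.exp (-((A + Q x) * t)))) := by
    unfold Function.uncurry
    fun_prop
  rw [lintegral_const_mul' _ _ ENNReal.ofReal_ne_top,
    lintegral_lintegral_swap hm.aemeasurable]
  have hinner : ∀ t ∈ Set.Ioi (0 : ℝ),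
      ∫⁻ x, ENNReal.ofReal (t ^ (s - 1) * Real.exp (-((A + Q x) * t))) ∂μ =
        ENNReal.ofReal G * ENNReal.ofReal (t ^ (s - δ - 1) * Real.exp (-(A * t))) := by
    intro t ht
    have ht : 0 < t := ht
    have : ∀ x, ENNReal.ofReal (t ^ (s - 1) * Real.exp (-((A + Q x) * t))) =
        ENNReal.ofReal (t ^ (s - 1) * Real.exp (-(A * t))) *
          ENNReal.ofReal (Real.exp (-(t * Q x))) := by
      intro x
      rw [← ENNReal.ofReal_mul (by positivity), mul_assoc, ← Real.exp_add]
      congr 3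
      ring
    simp_rw [this]
    rw [lintegral_const_mul _ (by fun_prop), hgauss t ht, ← ENNReal.ofReal_mul (by positivity),
      ← ENNReal.ofReal_mul hG]
    congr 1
    rw [show s - δ - 1 = (s - 1) + (-δ) by ring, Real.rpow_add ht]
    ring
  rw [setLIntegral_congr_fun measurableSet_Ioi hinner, lintegral_const_mul _ (by fun_prop),
    lintegral_rpow_mul_exp_neg_mul (sub_pos.2 hs) hA, ← ENNReal.ofReal_mul hG,
    ← ENNReal.ofReal_mul (by positivity)]
  congr 1
  rw [neg_sub]
  field_simp

theorem lintegral_exp_neg_mul_norm_sq {d : ℕ} {t : ℝ} (ht : 0 < t) :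
    ∫⁻ x : EuclideanSpace ℝ (Fin d), ENNReal.ofReal (Real.exp (-(t * ‖x‖ ^ 2))) =
      ENNReal.ofReal ((Real.pi / t) ^ ((d : ℝ) / 2)) := by
  have hpos : 0 < (Real.pi / t) ^ ((d : ℝ) / 2) := by positivity
  refine lintegral_ofReal_eq_of_integral_eq (Eventually.of_forall fun x => by positivity) ?_ hpos.ne'
  have := GaussianFourier.integral_rexp_neg_mul_sq_norm (V := EuclideanSpace ℝ (Fin d)) ht
  simpa [neg_mul] using this

theorem lintegral_exp_neg_mul_sum_norm_sq {d : ℕ} (k : ℕ) {a t : ℝ} (ha : 0 < a) (ht : 0 < t) :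
    ∫⁻ x : Fin k → EuclideanSpace ℝ (Fin d),
      ENNReal.ofReal (Real.exp (-(t * (a * ∑ m, ‖x m‖ ^ 2)))) ∂(prodMeasure volume k) =
      ENNReal.ofReal ((Real.pi / a) ^ ((d : ℝ) * k / 2) * t ^ (-((d : ℝ) * k / 2))) := by
  have hpos : 0 < (Real.pi / a) ^ ((d : ℝ) * k / 2) * t ^ (-((d : ℝ) * k / 2)) := by positivity
  refine lintegral_ofReal_eq_of_integral_eq (Eventually.of_forall fun x => by positivity) ?_ hpos.ne'
  have h1 : ∀ x : Fin k → EuclideanSpace ℝ (Fin d), Real.exp (-(t * (a * ∑ m, ‖x m‖ ^ 2))) =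
      ∏ m, Real.exp (-(t * a) * ‖x m‖ ^ 2) := by
    intro x
    rw [← Real.exp_sum, ← Finset.mul_sum]
    congr 1
    ring
  simp_rw [h1]
  rw [integral_fintype_prod_eq_prod (𝕜 := ℝ) (fun (_ : Fin k) (y : EuclideanSpace ℝ (Fin d)) =>
      Real.exp (-(t * a) * ‖y‖ ^ 2)),
    GaussianFourier.integral_rexp_neg_mul_sq_norm (V := EuclideanSpace ℝ (Fin d))
      (mul_pos ht ha), Finset.prod_const, Finset.card_univ, Fintype.card_fin,
    finrank_euclideanSpace_fin, ← Real.rpow_natCast, ← Real.rpow_mul (by positivity),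
    show Real.pi / (t * a) = Real.pi / a * t⁻¹ by field_simp, Real.mul_rpow (by positivity)
      (by positivity), Real.inv_rpow ht.le, Real.rpow_neg ht.le,
    show (d : ℝ) / 2 * k = (d : ℝ) * k / 2 by ring]

theorem integrable_and_integral_of_lintegral_ofReal {α : Type*} [MeasurableSpace α] {μ : Measure α}
    {f : α → ℝ} {a : ℝ} (hf : AEStronglyMeasurable f μ) (h0 : ∀ x, 0 ≤ f x) (ha : 0 ≤ a)
    (h : ∫⁻ x, ENNReal.ofReal (f x) ∂μ = ENNReal.ofReal a) :
    Integrable f μ ∧ ∫ x, f x ∂μ = a := by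
  refine ⟨⟨hf, ?_⟩, ?_⟩
  · rw [hasFiniteIntegral_iff_ofReal (Eventually.of_forall h0), h]
    exact ENNReal.ofReal_lt_top
  · rw [integral_eq_lintegral_of_nonneg_ae (Eventually.of_forall h0) hf, h,
      ENNReal.toReal_ofReal ha]

theorem integral_add_rpow_neg {X : Type*} [MeasurableSpace X] {μ : Measure X} [SFinite μ]
    {Q : X → ℝ} (hQm : Measurable Q) (hQ : ∀ x, 0 ≤ Q x) {G δ : ℝ} (hG : 0 ≤ G)
    (hgauss : ∀ t : ℝ, 0 < t →
      ∫⁻ x, ENNReal.ofReal (Real.exp (-(t * Q x))) ∂μ = ENNReal.ofReal (G * t ^ (-δ)))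
    {A s : ℝ} (hA : 0 < A) (hs0 : 0 < s) (hs : δ < s) :
    Integrable (fun x => (A + Q x) ^ (-s)) μ ∧
      ∫ x, (A + Q x) ^ (-s) ∂μ = G * Real.Gamma (s - δ) / Real.Gamma s * A ^ (δ - s) := by
  have hΓ := Real.Gamma_pos_of_pos hs0
  have hΓ' := Real.Gamma_pos_of_pos (sub_pos.2 hs)
  refine integrable_and_integral_of_lintegral_ofReal
    (by fun_prop : Measurable _).aestronglyMeasurable (fun x => ?_) (by positivity)
    (lintegral_add_rpow_neg hQm hQ hG hgauss hA hs0 hs)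
  exact Real.rpow_nonneg (add_nonneg hA.le (hQ x)) _

theorem integral_add_norm_sq_rpow_neg {d : ℕ} {a A s : ℝ} (ha : 0 < a) (hA : 0 < A) (hs0 : 0 < s)
    (hs : (d : ℝ) / 2 < s) :
    Integrable (fun x : EuclideanSpace ℝ (Fin d) => (A + a * ‖x‖ ^ 2) ^ (-s)) ∧
      ∫ x : EuclideanSpace ℝ (Fin d), (A + a * ‖x‖ ^ 2) ^ (-s) =
        (Real.pi / a) ^ ((d : ℝ) / 2) * Real.Gamma (s - (d : ℝ) / 2) / Real.Gamma s *
          A ^ ((d : ℝ) / 2 - s) := by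
  refine integral_add_rpow_neg (by fun_prop) (fun x => by positivity) (by positivity) ?_ hA hs0 hs
  intro t ht
  simp_rw [← mul_assoc]
  rw [lintegral_exp_neg_mul_norm_sq (mul_pos ht ha),
    show Real.pi / (t * a) = Real.pi / a * t⁻¹ by field_simp, Real.mul_rpow (by positivity)
      (by positivity), Real.inv_rpow ht.le, Real.rpow_neg ht.le]

theorem integral_add_sum_norm_sq_rpow_neg {d : ℕ} (k : ℕ) {a A s : ℝ} (ha : 0 < a) (hA : 0 < A)
    (hs0 : 0 < s) (hs : (d : ℝ) * k / 2 < s) :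
    Integrable (fun x : Fin k → EuclideanSpace ℝ (Fin d) => (A + a * ∑ m, ‖x m‖ ^ 2) ^ (-s))
        (prodMeasure volume k) ∧
      ∫ x : Fin k → EuclideanSpace ℝ (Fin d), (A + a * ∑ m, ‖x m‖ ^ 2) ^ (-s)
          ∂(prodMeasure volume k) =
        (Real.pi / a) ^ ((d : ℝ) * k / 2) * Real.Gamma (s - (d : ℝ) * k / 2) / Real.Gamma s *
          A ^ ((d : ℝ) * k / 2 - s) :=
  integral_add_rpow_neg (by fun_prop) (fun x => by positivity) (by positivity)
    (fun _ ht => lintegral_exp_neg_mul_sum_norm_sq k ha ht) hA hs0 hs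

/-! ### Negative powers of quadratic forms -/

section Radial

variable {X : Type*} [NormedAddCommGroup X] [NormedSpace ℝ X]

/-- The function `K (C + B(y, y)) ^ (-s)`. -/
noncomputable def radial (B : X →L[ℝ] X →L[ℝ] ℝ) (K C s : ℝ) (y : X) : ℝ := K * (C + B y y) ^ (-s)

variable {B : X →L[ℝ] X →L[ℝ] ℝ} {K C s : ℝ}

theorem add_form_pos (hC : 0 < C) (hB0 : ∀ y, 0 ≤ B y y) (y : X) : 0 < C + B y y :=
  add_pos_of_pos_of_nonneg hC (hB0 y)

theorem contDiff_radial (hC : 0 < C) (hB0 : ∀ y, 0 ≤ B y y) :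
    ContDiff ℝ ∞ (radial B K C s) := by
  unfold radial
  rw [contDiff_iff_contDiffAt]
  intro y
  refine contDiffAt_const.mul (ContDiffAt.rpow_const_of_ne ?_ (add_form_pos hC hB0 y).ne')
  exact contDiffAt_const.add (B.contDiff.contDiffAt.clm_apply contDiffAt_id)

/-- Each differentiation raises the exponent by one; this identity pays for the polynomial factors
that it produces. -/
theorem radial_succ_mul (hC : 0 < C) (hB0 : ∀ y, 0 ≤ B y y) (y : X) :
    radial B K C (s + 1) y * (C + B y y) = radial B K C s y := by
  have h := add_form_pos hC hB0 y
  rw [radial, radial, mul_assoc, ← Real.rpow_add_one h.ne']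
  congr 2
  ring

theorem hasFDerivAt_radial (hC : 0 < C) (hB0 : ∀ y, 0 ≤ B y y) (hBs : ∀ y z, B y z = B z y)
    (y : X) :
    HasFDerivAt (radial B K C s) ((-(2 * s) * radial B K C (s + 1) y) • B y) y := by
  have h := add_form_pos hC hB0 y
  have h1 : HasFDerivAt (fun y => C + B y y) ((2 : ℝ) • B y) y := by
    have := (B.hasFDerivAt (x := y)).clm_apply (hasFDerivAt_id y)
    refine (this.const_add C).congr_fderiv ?_
    ext z
    simp only [ContinuousLinearMap.comp_id, add_apply, smul_apply, ContinuousLinearMap.flip_apply,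
      smul_eq_mul, id]
    rw [hBs z y]
    ring
  have h2 := (h1.rpow_const (p := -s) (Or.inl h.ne')).const_mul K
  refine h2.congr_fderiv ?_
  ext z
  simp only [radial, smul_apply, smul_eq_mul]
  rw [show -(s + 1) = -s - 1 by ring]
  ring

theorem fderiv_radial_apply (hC : 0 < C) (hB0 : ∀ y, 0 ≤ B y y) (hBs : ∀ y z, B y z = B z y)
    (y w : X) :
    fderiv ℝ (radial B K C s) y w = -(2 * s) * radial B K C (s + 1) y * B y w := by
  rw [(hasFDerivAt_radial hC hB0 hBs y).fderiv]
  simp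

theorem fderiv_fderiv_radial_apply (hC : 0 < C) (hB0 : ∀ y, 0 ≤ B y y)
    (hBs : ∀ y z, B y z = B z y) (y u w : X) :
    fderiv ℝ (fun y => fderiv ℝ (radial B K C s) y w) y u =
      -(2 * s) * (-(2 * (s + 1)) * radial B K C (s + 1 + 1) y * B y u * B y w +
        radial B K C (s + 1) y * B u w) := by
  have h1 : (fun y => fderiv ℝ (radial B K C s) y w) =
      fun y => -(2 * s) * (radial B K C (s + 1) y * B y w) := by
    ext y
    rw [fderiv_radial_apply hC hB0 hBs]
    ring
  have h2 : HasFDerivAt (fun y => -(2 * s) * (radial B K C (s + 1) y * B y w)) _ y :=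
    (((hasFDerivAt_radial (K := K) (s := s + 1) hC hB0 hBs y).mul
      ((B.hasFDerivAt (x := y)).clm_apply (hasFDerivAt_const w y))).const_mul (-(2 * s)))
  rw [h1, h2.fderiv]
  simp
  ring

theorem two_mul_abs_form_le (hB0 : ∀ y, 0 ≤ B y y) (hBs : ∀ y z, B y z = B z y) (y u : X) :
    2 * |B y u| ≤ B y y + B u u := by
  have h1 := hB0 (y - u)
  have h2 := hB0 (y + u)
  simp only [map_sub, map_add, sub_apply, add_apply,
    hBs u y] at h1 h2
  rcases abs_cases (B y u) with ⟨h, -⟩ | ⟨h, -⟩ <;> rw [h] <;> linarith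

/-- A linear factor `B(y,u)` is absorbed by one factor `C + B(y,y)`, so the derivatives are
dominated by the function itself. -/
theorem abs_form_le (hC : 0 < C) (hB0 : ∀ y, 0 ≤ B y y) (hBs : ∀ y z, B y z = B z y) (y u : X) :
    |B y u| ≤ (1 + B u u / C) * (C + B y y) := by
  have h1 := two_mul_abs_form_le hB0 hBs y u
  have h2 : (1 + B u u / C) * (C + B y y) = C + B y y + B u u + B u u / C * B y y := by
    field_simp
    ring
  have h3 : 0 ≤ B u u / C * B y y := mul_nonneg (div_nonneg (hB0 u) hC.le) (hB0 y)
  rw [h2]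
  linarith [hB0 y, hB0 u]

theorem radial_nonneg (hK : 0 ≤ K) (hC : 0 < C) (hB0 : ∀ y, 0 ≤ B y y) (y : X) :
    0 ≤ radial B K C s y :=
  mul_nonneg hK (Real.rpow_nonneg (add_form_pos hC hB0 y).le _)

variable [MeasurableSpace X] [BorelSpace X] {μ : Measure X}

theorem integrable_radial_succ_mul_form (hK : 0 ≤ K) (hC : 0 < C) (hB0 : ∀ y, 0 ≤ B y y)
    (hBs : ∀ y z, B y z = B z y) (hi : Integrable (radial B K C s) μ) (w : X) :
    Integrable (fun y => radial B K C (s + 1) y * B y w) μ := by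
  have hc : Continuous fun y => radial B K C (s + 1) y * B y w :=
    (contDiff_radial hC hB0).continuous.mul (B.continuous.clm_apply continuous_const)
  refine (hi.const_mul (1 + B w w / C)).mono' hc.aestronglyMeasurable ?_
  refine Eventually.of_forall fun y => ?_
  have h0 := radial_nonneg (s := s + 1) hK hC hB0 y
  rw [Real.norm_eq_abs, abs_mul, abs_of_nonneg h0, ← radial_succ_mul (s := s) hC hB0]
  calc _ ≤ radial B K C (s + 1) y * ((1 + B w w / C) * (C + B y y)) :=
        mul_le_mul_of_nonneg_left (abs_form_le hC hB0 hBs y w) h0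
    _ = _ := by ring

theorem integrable_radial_succ (hK : 0 ≤ K) (hC : 0 < C) (hB0 : ∀ y, 0 ≤ B y y)
    (hi : Integrable (radial B K C s) μ) :
    Integrable (radial B K C (s + 1)) μ := by
  refine (hi.const_mul (1 / C)).mono' (contDiff_radial hC hB0).continuous.aestronglyMeasurable ?_
  refine Eventually.of_forall fun y => ?_
  have h0 := radial_nonneg (s := s + 1) hK hC hB0 y
  rw [Real.norm_eq_abs, abs_of_nonneg h0, ← radial_succ_mul (s := s) hC hB0, one_div_mul_eq_div,
    le_div_iff₀ hC]
  exact mul_le_mul_of_nonneg_left (by linarith [hB0 y]) h0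

theorem integrable_radial_succ_succ_mul_form (hK : 0 ≤ K) (hC : 0 < C) (hB0 : ∀ y, 0 ≤ B y y)
    (hBs : ∀ y z, B y z = B z y) (hi : Integrable (radial B K C s) μ) (u w : X) :
    Integrable (fun y => radial B K C (s + 1 + 1) y * B y u * B y w) μ := by
  have hc : Continuous fun y => radial B K C (s + 1 + 1) y * B y u * B y w :=
    ((contDiff_radial hC hB0).continuous.mul (B.continuous.clm_apply continuous_const)).mul
      (B.continuous.clm_apply continuous_const)
  refine (hi.const_mul ((1 + B u u / C) * (1 + B w w / C))).mono' hc.aestronglyMeasurable ?_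
  refine Eventually.of_forall fun y => ?_
  have h0 := radial_nonneg (s := s + 1 + 1) hK hC hB0 y
  rw [Real.norm_eq_abs, abs_mul, abs_mul, abs_of_nonneg h0, ← radial_succ_mul (s := s) hC hB0,
    ← radial_succ_mul (s := s + 1) hC hB0, mul_assoc]
  calc _ ≤ radial B K C (s + 1 + 1) y * (((1 + B u u / C) * (C + B y y)) *
          ((1 + B w w / C) * (C + B y y))) := by
        refine mul_le_mul_of_nonneg_left (mul_le_mul (abs_form_le hC hB0 hBs y u)
          (abs_form_le hC hB0 hBs y w) (abs_nonneg _) ?_) h0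
        exact (abs_nonneg _).trans (abs_form_le hC hB0 hBs y u)
    _ = _ := by ring

theorem integrable_fderiv_radial (hK : 0 ≤ K) (hC : 0 < C) (hB0 : ∀ y, 0 ≤ B y y)
    (hBs : ∀ y z, B y z = B z y) (hi : Integrable (radial B K C s) μ) (w : X) :
    Integrable (fun y => fderiv ℝ (radial B K C s) y w) μ := by
  simp_rw [fderiv_radial_apply hC hB0 hBs, mul_assoc]
  exact (integrable_radial_succ_mul_form hK hC hB0 hBs hi w).const_mul _

theorem integrable_fderiv_fderiv_radial (hK : 0 ≤ K) (hC : 0 < C) (hB0 : ∀ y, 0 ≤ B y y)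
    (hBs : ∀ y z, B y z = B z y) (hi : Integrable (radial B K C s) μ) (u w : X) :
    Integrable (fun y => fderiv ℝ (fun y => fderiv ℝ (radial B K C s) y w) y u) μ := by
  simp_rw [fderiv_fderiv_radial_apply hC hB0 hBs]
  refine Integrable.const_mul (Integrable.add ?_ ?_) _
  · exact ((integrable_radial_succ_succ_mul_form hK hC hB0 hBs hi u w).const_mul
      (-(2 * (s + 1)))).congr (Eventually.of_forall fun y => by ring)
  · exact (integrable_radial_succ hK hC hB0 hi).mul_const _

/-- Integration by parts against the constant function `1`. -/
theorem integral_fderiv_eq_zero [FiniteDimensional ℝ X] [μ.IsAddHaarMeasure] {f : X → ℝ} (hf : Differentiable ℝ f)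
    (hi : Integrable f μ) {u : X} (hi' : Integrable (fun y => fderiv ℝ f y u) μ) :
    ∫ y, fderiv ℝ f y u ∂μ = 0 := by
  have h := integral_bilinear_hasFDerivAt_right_eq_neg_left_of_integrable (μ := μ)
    (f := fun _ : X => (1 : ℝ)) (f' := fun _ => 0) (g := f) (g' := fderiv ℝ f) (v := u)
    (B := ContinuousLinearMap.mul ℝ ℝ) (by simp) (by simpa using hi') (by simpa using hi)
    (fun x _ => hasFDerivAt_const _ _) (fun x _ => (hf x).hasFDerivAt)
  simpa using h

end Radial

/-! ### Location families of densities -/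

section JointSmooth

variable {X : Type*} [NormedAddCommGroup X] [NormedSpace ℝ X]
  {n : ℕ} {M : Type*} [TopologicalSpace M] [ChartedSpace (EuclideanSpace ℝ (Fin n)) M]
  [IsManifold (𝓡 n) ∞ M] {φ : M ≃ₜ EuclideanSpace ℝ (Fin n)}

/-- Smoothness is carried jointly in the location and `x`, so that it survives iteration and also
yields measurability in `x`. -/
theorem contDiff_vderiv
    (hφ : ∀ p : M, chartAt (EuclideanSpace ℝ (Fin n)) p = φ.toOpenPartialHomeomorph)
    {V : ∀ p : M, TangentSpace (𝓡 n) p} (hV : IsSmoothField V) {f : M → X → ℝ}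
    (hf : ContDiff ℝ ∞ fun z : EuclideanSpace ℝ (Fin n) × X => f (φ.symm z.1) z.2) :
    ContDiff ℝ ∞ fun z : EuclideanSpace ℝ (Fin n) × X =>
      vderiv V (fun p => f p z.2) (φ.symm z.1) := by
  have h1 : ∀ z : EuclideanSpace ℝ (Fin n) × X, vderiv V (fun p => f p z.2) (φ.symm z.1) =
      fderiv ℝ (fun v => f (φ.symm v) z.2) z.1 (fieldCoord φ V z.1) := by
    intro z
    have hz : ContDiff ℝ ∞ fun v => f (φ.symm v) z.2 :=
      hf.comp (contDiff_id.prodMk contDiff_const)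
    rw [vderiv_eq_fderiv hφ V (hz.differentiable (by simp)), φ.apply_symm_apply]
  simp_rw [h1]
  refine ContDiff.clm_apply ?_ ((contDiff_fieldCoord hφ hV).comp contDiff_fst)
  refine ContDiff.fderiv (m := ∞) (n := ∞) (f := fun (z : EuclideanSpace ℝ (Fin n) × X) v =>
    f (φ.symm v) z.2) ?_ contDiff_fst (by simp)
  exact hf.comp (contDiff_snd.prodMk (contDiff_snd.comp contDiff_fst))

theorem contDiff_foldr_vderiv
    (hφ : ∀ p : M, chartAt (EuclideanSpace ℝ (Fin n)) p = φ.toOpenPartialHomeomorph)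
    {f : M → X → ℝ}
    (hf : ContDiff ℝ ∞ fun z : EuclideanSpace ℝ (Fin n) × X => f (φ.symm z.1) z.2)
    (Vs : List (∀ p : M, TangentSpace (𝓡 n) p)) (hVs : ∀ V ∈ Vs, IsSmoothField V) :
    ContDiff ℝ ∞ fun z : EuclideanSpace ℝ (Fin n) × X =>
      Vs.foldr vderiv (fun p => f p z.2) (φ.symm z.1) := by
  induction Vs with
  | nil => exact hf
  | cons V Vs ih =>
    exact contDiff_vderiv (f := fun p x => Vs.foldr vderiv (fun p' => f p' x) p) hφ
      (hVs V (by simp)) (ih fun W hW => hVs W (by simp [hW]))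

end JointSmooth

/-! ### Derivatives with respect to the location -/

section Translation

variable {E X : Type*} [NormedAddCommGroup X] [NormedSpace ℝ X] [NormedAddCommGroup E]
  [NormedSpace ℝ E] {J : E →L[ℝ] X} {g : X → ℝ}

theorem hasFDerivAt_sub_apply (x : X) (v : E) : HasFDerivAt (fun v => x - J v) (-J) v :=
  J.hasFDerivAt.const_sub x

theorem fderiv_comp_sub_apply (hg : ContDiff ℝ ∞ g) (x : X) (v u : E) :
    fderiv ℝ (fun v => g (x - J v)) v u = -fderiv ℝ g (x - J v) (J u) := by
  have h := ((hg.differentiable (by simp) (x - J v)).hasFDerivAt).comp v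
    (hasFDerivAt_sub_apply (J := J) x v)
  rw [show (fun v => g (x - J v)) = g ∘ fun v => x - J v from rfl, h.fderiv]
  simp

theorem fderiv_neg_fderiv_comp_sub_apply (hg : ContDiff ℝ ∞ g) {W : E → E}
    (hW : Differentiable ℝ W) (x : X) (v u : E) :
    fderiv ℝ (fun v => -fderiv ℝ g (x - J v) (J (W v))) v u =
      fderiv ℝ (fun y => fderiv ℝ g y (J (W v))) (x - J v) (J u) -
        fderiv ℝ g (x - J v) (J (fderiv ℝ W v u)) := by
  have hg' : ContDiff ℝ ∞ (fderiv ℝ g) := hg.fderiv_right (by simp)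
  have hd := (hg'.differentiable (by simp) (x - J v)).hasFDerivAt
  have h1 := hd.comp v (hasFDerivAt_sub_apply (J := J) x v)
  have h2 : HasFDerivAt (fun v => J (W v)) (J.comp (fderiv ℝ W v)) v :=
    J.hasFDerivAt.comp v (hW v).hasFDerivAt
  have h3 : HasFDerivAt (fun v => -fderiv ℝ g (x - J v) (J (W v))) _ v := (h1.clm_apply h2).neg
  have h4 : HasFDerivAt (fun y => fderiv ℝ g y (J (W v))) _ (x - J v) :=
    hd.clm_apply (hasFDerivAt_const _ _)
  rw [h3.fderiv, h4.fderiv]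
  simp
  ring

end Translation

/-! ### Translates of a negative power of a quadratic form as a statistical model -/

section Model

variable {X : Type*} [NormedAddCommGroup X] [NormedSpace ℝ X] {n : ℕ}
  {B : X →L[ℝ] X →L[ℝ] ℝ} {J : EuclideanSpace ℝ (Fin n) →L[ℝ] X} {K C s κ : ℝ}

theorem form_eq_of_radial (hK : 0 < K) (hC : 0 < C) (hs : 0 < s) (hB0 : ∀ y, 0 ≤ B y y) (y : X) :
    B y y = (K⁻¹ * radial B K C s y) ^ (-(1 / s)) - C := by
  have h := add_form_pos hC hB0 y
  rw [radial, inv_mul_cancel_left₀ hK.ne', ← Real.rpow_mul h.le,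
    show -s * -(1 / s) = 1 by field_simp, Real.rpow_one]
  ring

/-- The density at `x` determines `B(x - Jφ, x - Jφ)` continuously. Polarization, with the values at
`x = 0` and `x = Jw`, recovers `⟨w, φ⟩`. Hence the evaluations induce the topology of the chart. -/
theorem continuous_of_continuous_radial {M : Type*} [TopologicalSpace M]
    {φ : M → EuclideanSpace ℝ (Fin n)} (hK : 0 < K) (hC : 0 < C) (hs : 0 < s)
    (hB0 : ∀ y, 0 ≤ B y y) (hBs : ∀ y z, B y z = B z y) (hκ : 0 < κ)
    (hJ : ∀ v w, B (J v) (J w) = κ * inner ℝ v w)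
    (h : ∀ x, Continuous fun p => radial B K C s (x - J (φ p))) : Continuous φ := by
  have h1 : ∀ x, Continuous fun p => B (x - J (φ p)) (x - J (φ p)) := by
    intro x
    simp_rw [form_eq_of_radial hK hC hs hB0 (x - J (φ _))]
    refine ((continuous_const.mul (h x)).rpow_const fun p => Or.inl ?_).sub continuous_const
    have := mul_pos hK (Real.rpow_pos_of_pos (add_form_pos hC hB0 (x - J (φ p))) (-s))
    exact (mul_pos (inv_pos.2 hK) this).ne'
  have h2 : ∀ w, Continuous fun p => inner ℝ w (φ p) := by
    intro w
    have : ∀ p, inner ℝ w (φ p) = (2 * κ)⁻¹ * (B (0 - J (φ p)) (0 - J (φ p)) -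
        B (J w - J (φ p)) (J w - J (φ p)) + B (J w) (J w)) := by
      intro p
      have h3 := hJ w (φ p)
      simp only [map_sub, sub_apply, map_zero, zero_apply, hBs (J (φ p)) (J w), h3]
      field_simp
      ring
    simp_rw [this]
    exact continuous_const.mul (((h1 0).sub (h1 (J w))).add continuous_const)
  have h3 : φ = fun p => WithLp.toLp 2 fun i => φ p i := rfl
  rw [h3]
  refine (PiLp.continuous_toLp 2 _).comp (continuous_pi fun i => ?_)
  simpa [EuclideanSpace.inner_single_left] using h2 (EuclideanSpace.single i 1)

variable [MeasurableSpace X] [BorelSpace X] {μ : Measure X}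
  [μ.IsAddHaarMeasure]
  {M : Type*} [tM : TopologicalSpace M] [ChartedSpace (EuclideanSpace ℝ (Fin n)) M]
  [IsManifold (𝓡 n) ∞ M] {φ : M ≃ₜ EuclideanSpace ℝ (Fin n)} {e : M → X → ℝ}

theorem isDensity_radial_translate (hK : 0 < K) (hC : 0 < C) (hB0 : ∀ y, 0 ≤ B y y)
    (hi : Integrable (radial B K C s) μ) (h1 : ∫ y, radial B K C s y ∂μ = 1) (a : X) :
    IsDensity μ (Set.Ioi 0) (fun x => radial B K C s (x - a)) where
  integrable := hi.comp_sub_right a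
  mem := Eventually.of_forall fun _ =>
    mul_pos hK (Real.rpow_pos_of_pos (add_form_pos hC hB0 _) (-s))
  integral_eq_one := by rw [integral_sub_right_eq_self (radial B K C s) a, h1]

variable [FiniteDimensional ℝ X]

/-- A family of translates of a negative power of a quadratic form is a statistical model. -/
theorem isStatisticalModel_radial
    (hφ : ∀ p : M, chartAt (EuclideanSpace ℝ (Fin n)) p = φ.toOpenPartialHomeomorph)
    (hK : 0 < K) (hC : 0 < C) (hs : 0 < s)
    (hB0 : ∀ y, 0 ≤ B y y) (hBs : ∀ y z, B y z = B z y) (hκ : 0 < κ)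
    (hJ : ∀ v w, B (J v) (J w) = κ * inner ℝ v w)
    (hi : Integrable (radial B K C s) μ) (h1 : ∫ y, radial B K C s y ∂μ = 1)
    (he : ∀ p x, e p x = radial B K C s (x - J (φ p))) :
    IsStatisticalModel μ n e := by
  have hg : ContDiff ℝ ∞ (radial B K C s) := contDiff_radial hC hB0
  have hjoint : ContDiff ℝ ∞ fun z : EuclideanSpace ℝ (Fin n) × X => e (φ.symm z.1) z.2 := by
    simp_rw [he, φ.apply_symm_apply]
    exact hg.comp (contDiff_snd.sub (J.contDiff.comp contDiff_fst))
  have hsmooth : ∀ x, ContDiff ℝ ∞ fun v => e (φ.symm v) x := fun x =>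
    hjoint.comp (contDiff_id.prodMk contDiff_const)
  have hvd : ∀ (V : ∀ p : M, TangentSpace (𝓡 n) p) (p : M) (x : X),
      vderiv V (fun p' => e p' x) p =
        -fderiv ℝ (radial B K C s) (x - J (φ p)) (J (fieldCoord φ V (φ p))) := by
    intro V p x
    rw [vderiv_eq_fderiv hφ V ((hsmooth x).differentiable (by simp))]
    simp_rw [he, φ.apply_symm_apply]
    rw [fderiv_comp_sub_apply hg]
  have hfd := fun w : X => integrable_fderiv_radial hK.le hC hB0 hBs hi w
  have hfd0 : ∀ w : X, ∫ y, fderiv ℝ (radial B K C s) y w ∂μ = 0 := fun w =>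
    integral_fderiv_eq_zero (hg.differentiable (by simp)) hi (hfd w)
  have hfdd := fun u w : X => integrable_fderiv_fderiv_radial hK.le hC hB0 hBs hi u w
  have hfdd0 : ∀ u w : X,
      ∫ y, fderiv ℝ (fun y => fderiv ℝ (radial B K C s) y w) y u ∂μ = 0 := fun u w =>
    integral_fderiv_eq_zero (((hg.fderiv_right (m := ∞) (by simp)).clm_apply
      contDiff_const).differentiable (by simp)) (hfd w) (hfdd u w)
  have hcont : ∀ p, Continuous (e p) := by
    intro p
    simp_rw [funext (he p)]
    exact hg.continuous.comp (continuous_id.sub continuous_const)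
  refine
    { t2 := φ.symm.t2Space
      secondCountable := φ.secondCountableTopology
      connected := φ.symm.surjective.connectedSpace φ.symm.continuous
      density := fun p => ?_
      injective := fun p p' hpp' => ?_
      exists_null := ⟨∅, measure_empty, ?_, fun x _ => contMDiff_of_contDiff hφ (hsmooth x), ?_, ?_⟩
      integral_deriv := fun V W hV hW p => ?_ }
  · rw [funext (he p)]
    exact isDensity_radial_translate hK hC hB0 hi h1 _
  -- Almost everywhere equal continuous densities are equal, because Haar measure charges open sets.
  -- Evaluating at the centre of `p` shows that the centre of `p'` is at distance zero from it.
  · have h2 := congrFun (((hcont p).ae_eq_iff_eq μ (hcont p')).1 hpp') (J (φ p))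
    have h3 := form_eq_of_radial hK hC hs hB0 (J (φ p) - J (φ p'))
    rw [← he, ← h2, he, ← form_eq_of_radial hK hC hs hB0, sub_self, map_zero, ← map_sub, hJ] at h3
    have h4 := inner_self_eq_zero.1 ((mul_eq_zero.1 h3).resolve_left hκ.ne')
    exact φ.injective (sub_eq_zero.1 h4)
  · refine le_antisymm (le_iInf fun x => continuous_iff_le_induced.1 ?_) ?_
    · have : (fun p => e p (x : X)) = (fun v => e (φ.symm v) (x : X)) ∘ φ := by
        ext; simp
      rw [this]
      exact (hsmooth x).continuous.comp φ.continuous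
    · rw [φ.isInducing.eq_induced]
      refine continuous_iff_le_induced.1 ?_
      -- The topology on `M` is given explicitly: here it is the one induced by the evaluations, not
      -- the one of the manifold.
      refine @continuous_of_continuous_radial X _ _ n B J K C s κ M
        (⨅ x : ↥(∅ᶜ : Set X), TopologicalSpace.induced (fun p : M => e p x) inferInstance) φ hK hC hs hB0 hBs hκ hJ ?_
      intro x
      simp_rw [← he]
      exact continuous_iff_le_induced.2 (iInf_le _ (⟨x, by simp⟩ : ↥(∅ᶜ : Set X)))
  · intro Vs hVs p
    have h2 := contDiff_foldr_vderiv hφ hjoint Vs hVs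
    have h3 : Continuous fun x : X => Vs.foldr vderiv (fun p' => e p' x) p := by
      have := h2.continuous.comp (continuous_const.prodMk continuous_id : Continuous fun x : X =>
        (φ p, x))
      simpa [Function.comp_def] using this
    exact (h3.comp continuous_subtype_val).measurable
  · intro V _ p
    refine ⟨fun h => ?_, fun h x _ => ?_⟩
    · rw [← fieldCoord_apply (φ := φ) V p]
      set w := fieldCoord φ V (φ p) with hw
      -- At the point displaced from the centre by `Jw`, the derivative in direction `w` is a
      -- positive multiple of `|w|²`.
      have h2 := h (J (φ p) + J w) (by simp)
      rw [hvd, fderiv_radial_apply hC hB0 hBs, ← hw, add_sub_cancel_left, hJ] at h2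
      have h3 : 0 < radial B K C (s + 1) (J w) :=
        mul_pos hK (Real.rpow_pos_of_pos (add_form_pos hC hB0 _) _)
      have h5 : 2 * s * radial B K C (s + 1) (J w) * κ ≠ 0 := by positivity
      have h6 : 2 * s * radial B K C (s + 1) (J w) * κ * inner ℝ w w = 0 := by
        rw [← h2]; ring
      exact inner_self_eq_zero.1 ((mul_eq_zero.1 h6).resolve_left h5)
    · rw [hvd, show fieldCoord φ V (φ p) = 0 from (fieldCoord_apply V p).trans h, map_zero,
        map_zero, neg_zero]
  · have hW' := (contDiff_fieldCoord hφ hW).differentiable (by simp)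
    have hvdd : ∀ x, vderiv V (vderiv W (fun p' => e p' x)) p =
        fderiv ℝ (fun y => fderiv ℝ (radial B K C s) y (J (fieldCoord φ W (φ p))))
            (x - J (φ p)) (J (fieldCoord φ V (φ p))) -
          fderiv ℝ (radial B K C s) (x - J (φ p))
            (J (fderiv ℝ (fieldCoord φ W) (φ p) (fieldCoord φ V (φ p)))) := by
      intro x
      have hd : ContDiff ℝ ∞ fun v => vderiv W (fun p' => e p' x) (φ.symm v) :=
        (contDiff_vderiv hφ hW hjoint).comp (contDiff_id.prodMk contDiff_const)
      rw [vderiv_eq_fderiv hφ V (hd.differentiable (by simp))]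
      simp_rw [hvd, φ.apply_symm_apply]
      exact fderiv_neg_fderiv_comp_sub_apply hg hW' x (φ p) (fieldCoord φ V (φ p))
    simp_rw [hvd, hvdd]
    refine ⟨((hfd _).comp_sub_right _).neg, ((hfdd _ _).comp_sub_right _).sub
      ((hfd _).comp_sub_right _), ?_, ?_⟩
    · rw [integral_neg, integral_sub_right_eq_self
        (fun y => fderiv ℝ (radial B K C s) y (J (fieldCoord φ V (φ p)))), hfd0, neg_zero]
    · rw [integral_sub ((hfdd _ _).comp_sub_right _) ((hfd _).comp_sub_right _),
        integral_sub_right_eq_self (fun y => fderiv ℝ (fun y => fderiv ℝ (radial B K C s) y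
          (J (fieldCoord φ W (φ p)))) y (J (fieldCoord φ V (φ p)))), integral_sub_right_eq_self
        (fun y => fderiv ℝ (radial B K C s) y (J (fderiv ℝ (fieldCoord φ W) (φ p) (fieldCoord φ V (φ p))))),
        hfd0, hfdd0, sub_zero]

end Model

/-! ### A strong law of large numbers for reflection invariant sequences -/

section StrongLaw

/-- **Kronecker's lemma** for the weights `n`. -/
theorem tendsto_average_of_tendsto_sum_div {a : ℕ → ℝ} (ha : a 0 = 0) {c : ℝ}
    (h : Tendsto (fun n => ∑ i ∈ Finset.range n, a i / i) atTop (𝓝 c)) :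
    Tendsto (fun n : ℕ => (n : ℝ)⁻¹ * ∑ i ∈ Finset.range n, a i) atTop (𝓝 0) := by
  -- Summation by parts. With `s_n` the partial sums of `a i / i`, the average of the `a i` is `s_n`
  -- minus the Cesàro mean of the `s_(i+1)`. Since `a 0 / 0 = 0`, the term `a 0` would be lost if it
  -- were not zero.
  have habel : ∀ n : ℕ, ∑ i ∈ Finset.range n, a i = n * (∑ i ∈ Finset.range n, a i / i) -
      ∑ i ∈ Finset.range n, ∑ j ∈ Finset.range (i + 1), a j / j := by
    intro n
    induction n with
    | zero => simp
    | succ n ih =>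
      rw [Finset.sum_range_succ a, ih,
        Finset.sum_range_succ (fun i => ∑ j ∈ Finset.range (i + 1), a j / j),
        Finset.sum_range_succ (fun i : ℕ => a i / i)]
      rcases eq_or_ne n 0 with rfl | hn
      · simp [ha]
      · push_cast
        field_simp
        ring
  have h1 := (h.comp (tendsto_add_atTop_nat 1)).cesaro
  have h2 := h.sub h1
  rw [sub_self] at h2
  refine h2.congr' ?_
  filter_upwards [eventually_ne_atTop 0] with n hn
  rw [habel n, mul_sub, inv_mul_cancel_left₀ (Nat.cast_ne_zero.2 hn)]
  rfl

/-- The odd truncation of the identity at the level `A`. -/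
noncomputable def cutoff (A x : ℝ) : ℝ := Set.indicator {y | |y| ≤ A} id x

theorem measurable_cutoff (A : ℝ) : Measurable (cutoff A) :=
  measurable_id.indicator (measurableSet_le measurable_id.abs measurable_const)

theorem cutoff_neg (A x : ℝ) : cutoff A (-x) = -cutoff A x := by
  by_cases h : |x| ≤ A <;> simp [cutoff, h]

theorem abs_cutoff_le {A : ℝ} (hA : 0 ≤ A) (x : ℝ) : |cutoff A x| ≤ A := by
  by_cases h : |x| ≤ A <;> simp [cutoff, h, hA]

theorem cutoff_eq_self {A x : ℝ} (h : |x| ≤ A) : cutoff A x = x := by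
  simp [cutoff, h]

/-- `ProbabilityTheory.truncation` keeps the values in `(-A, A]` and is not odd. The squares agree
once `f` is replaced by `|f|`, which gives access to the variance bounds for truncations. -/
theorem cutoff_sq_eq_truncation {α : Type*} (f : α → ℝ) (A : ℝ) (x : α) :
    cutoff A (f x) ^ 2 = ProbabilityTheory.truncation (fun x => |f x|) A x ^ 2 := by
  rw [ProbabilityTheory.truncation_eq_of_nonneg fun _ => abs_nonneg _]
  by_cases h : |f x| ≤ A
  · by_cases h0 : f x = 0
    · simp [cutoff, h0]
    · simp [cutoff, h, Set.indicator, h0]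
  · simp [cutoff, h, Set.indicator]

variable {Ω : Type*} [MeasurableSpace Ω] {P : Measure Ω} {ξ : ℕ → Ω → ℝ}

/-- Changing the sign of the last variable preserves the law and negates the integrand, so the
integral equals its own negative. With `Φ` an indicator this is the martingale property of odd
truncations; with `Φ` a partial sum it is their orthogonality. -/
theorem integral_mul_odd_eq_zero
    (hrefl : ∀ n : ℕ, ProbabilityTheory.IdentDistrib (fun w (m : Fin (n + 1)) => ξ m w)
      (fun w m => if m = Fin.last n then -ξ m w else ξ m w) P P)
    {n : ℕ} {Φ : (Fin n → ℝ) → ℝ} {g : ℝ → ℝ} (hΦ : Measurable Φ) (hg : Measurable g)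
    (hodd : ∀ x, g (-x) = -g x) :
    ∫ w, Φ (fun m => ξ m w) * g (ξ n w) ∂P = 0 := by
  have hF : Measurable fun y : Fin (n + 1) → ℝ =>
      Φ (fun m => y m.castSucc) * g (y (Fin.last n)) :=
    (hΦ.comp (measurable_pi_lambda _ fun m => measurable_pi_apply _)).mul
      (hg.comp (measurable_pi_apply _))
  have h := ((hrefl n).comp hF).integral_eq
  have hne : ∀ m : Fin n, (m.castSucc = Fin.last n) = False := fun m =>
    eq_false (Fin.castSucc_lt_last m).ne
  simp only [Function.comp_def, Fin.val_castSucc, Fin.val_last, hne, if_false, if_true, hodd,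
    mul_neg, integral_neg] at h
  linarith

variable [IsProbabilityMeasure P]

theorem integral_cutoff_sq_le (hint : Integrable (ξ 0) P)
    (hident : ∀ n, ProbabilityTheory.IdentDistrib (ξ n) (ξ 0) P P) (K : ℕ) :
    ∑ j ∈ Finset.range K, ((j : ℝ) ^ 2)⁻¹ * ∫ w, cutoff j (ξ j w) ^ 2 ∂P ≤
      2 * ∫ w, |ξ 0 w| ∂P := by
  -- The bound for truncated second moments is stated for the canonical measure of a `MeasureSpace`.
  let : MeasureSpace Ω := ⟨P⟩
  have h := ProbabilityTheory.sum_variance_truncation_le (Ω := Ω) (X := fun w => |ξ 0 w|)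
    hint.abs (fun _ => abs_nonneg _) K
  refine le_trans (le_of_eq (Finset.sum_congr rfl fun j _ => ?_)) h
  congr 1
  refine (((hident j).comp ((measurable_cutoff j).pow_const 2)).integral_eq).trans ?_
  exact integral_congr_ae (Eventually.of_forall fun w =>
    cutoff_sq_eq_truncation (ξ 0) j w)

/-- Borel–Cantelli: by identical distribution and integrability, the probabilities of `|ξ_j| > j`
are summable. -/
theorem ae_eventually_cutoff_eq_self (hint : Integrable (ξ 0) P)
    (hident : ∀ n, ProbabilityTheory.IdentDistrib (ξ n) (ξ 0) P P) :
    ∀ᵐ w ∂P, ∀ᶠ n : ℕ in atTop, cutoff n (ξ n w) = ξ n w := by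
  let : MeasureSpace Ω := ⟨P⟩
  have h := ProbabilityTheory.tsum_prob_mem_Ioi_lt_top (Ω := Ω) (X := fun w => |ξ 0 w|)
    hint.abs (fun _ => abs_nonneg _)
  have h' : ∑' j : ℕ, P {w | |ξ j w| ∈ Set.Ioi (j : ℝ)} ≠ ⊤ := by
    refine ne_of_lt (lt_of_le_of_lt (le_of_eq (tsum_congr fun j => ?_)) h)
    exact ((hident j).comp measurable_id.abs).measure_mem_eq measurableSet_Ioi
  filter_upwards [ae_eventually_notMem h'] with w hw
  filter_upwards [hw] with n hn
  exact cutoff_eq_self (not_lt.1 hn)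

theorem measurable_sum_cutoff (n : ℕ) :
    Measurable fun y : Fin n → ℝ => ∑ i : Fin n, cutoff (i : ℕ) (y i) / (i : ℕ) :=
  Finset.measurable_sum _ fun i _ =>
    ((measurable_cutoff _).comp (measurable_pi_apply i)).div_const _

/-- The partial sums form a martingale bounded in `L²`, hence in `L¹`, so Doob's theorem gives
almost sure convergence. -/
theorem exists_tendsto_sum_cutoff_div (hm : ∀ n, Measurable (ξ n)) (hint : Integrable (ξ 0) P)
    (hident : ∀ n, ProbabilityTheory.IdentDistrib (ξ n) (ξ 0) P P)
    (hrefl : ∀ n : ℕ, ProbabilityTheory.IdentDistrib (fun w (m : Fin (n + 1)) => ξ m w)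
      (fun w m => if m = Fin.last n then -ξ m w else ξ m w) P P) :
    ∀ᵐ w ∂P, ∃ c, Tendsto (fun n => ∑ i ∈ Finset.range n, cutoff (i : ℕ) (ξ i w) / (i : ℕ))
      atTop (𝓝 c) := by
  set S : ℕ → Ω → ℝ := fun n w => ∑ i ∈ Finset.range n, cutoff (i : ℕ) (ξ i w) / (i : ℕ) with hS
  have hZm : ∀ i : ℕ, Measurable fun w => cutoff (i : ℕ) (ξ i w) / (i : ℕ) := fun i =>
    ((measurable_cutoff _).comp (hm i)).div_const _
  have hSm : ∀ n, Measurable (S n) := fun n => Finset.measurable_sum _ fun i _ => hZm i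
  have hZb : ∀ (i : ℕ) (w : Ω), |cutoff (i : ℕ) (ξ i w) / (i : ℕ)| ≤ 1 := by
    intro i w
    rw [abs_div, Nat.abs_cast]
    exact div_le_one_of_le₀ (abs_cutoff_le (Nat.cast_nonneg i) _) (Nat.cast_nonneg i)
  have hSb : ∀ n w, |S n w| ≤ n := by
    intro n w
    refine (Finset.abs_sum_le_sum_abs _ _).trans ?_
    refine (Finset.sum_le_sum fun i _ => hZb i w).trans (by simp)
  have hbdd : ∀ {f : Ω → ℝ} (C : ℝ), Measurable f → (∀ w, |f w| ≤ C) → Integrable f P :=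
    fun C hf hC => Integrable.of_bound hf.aestronglyMeasurable C (Eventually.of_forall hC)
  have hSi : ∀ n, Integrable (S n) P := fun n => hbdd n (hSm n) (hSb n)
  have hSF : ∀ n w, S n w = ∑ i : Fin n, cutoff ((i : ℕ) : ℝ) (ξ i w) / (i : ℕ) := fun n w =>
    Finset.sum_range fun i => cutoff (i : ℕ) (ξ i w) / (i : ℕ)
  -- Orthogonality of the increments: the cross term is a function of the past times an odd function
  -- of the last variable.
  have hS2 : ∀ n, ∫ w, S n w ^ 2 ∂P =
      ∑ j ∈ Finset.range n, ((j : ℝ) ^ 2)⁻¹ * ∫ w, cutoff j (ξ j w) ^ 2 ∂P := by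
    intro n
    induction n with
    | zero => simp [hS]
    | succ n ih =>
      have h1 : ∀ w, S (n + 1) w ^ 2 = S n w ^ 2 + 2 * (S n w * (cutoff n (ξ n w) / n)) +
          ((n : ℝ) ^ 2)⁻¹ * cutoff n (ξ n w) ^ 2 := by
        intro w
        simp only [hS, Finset.sum_range_succ]
        rw [add_sq, div_pow]
        ring
      have h2 : ∫ w, S n w * (cutoff n (ξ n w) / n) ∂P = 0 := by
        simp_rw [hSF]
        exact integral_mul_odd_eq_zero hrefl (measurable_sum_cutoff n)
          ((measurable_cutoff n).div_const _) fun x => by rw [cutoff_neg, neg_div]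
      have i1 : Integrable (fun w => S n w ^ 2) P :=
        hbdd ((n : ℝ) ^ 2) ((hSm n).pow_const 2) fun w => by
          rw [abs_pow]
          exact pow_le_pow_left₀ (abs_nonneg _) (hSb n w) 2
      have i2 : Integrable (fun w => 2 * (S n w * (cutoff n (ξ n w) / n))) P := by
        refine Integrable.const_mul (hbdd n ((hSm n).mul (hZm n)) fun w => ?_) 2
        rw [Pi.mul_apply, abs_mul]
        calc _ ≤ (n : ℝ) * 1 :=
              mul_le_mul (hSb n w) (hZb n w) (abs_nonneg _) (Nat.cast_nonneg n)
          _ = n := mul_one _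
      have i3 : Integrable (fun w => ((n : ℝ) ^ 2)⁻¹ * cutoff n (ξ n w) ^ 2) P := by
        refine Integrable.const_mul (hbdd ((n : ℝ) ^ 2)
          (((measurable_cutoff n).comp (hm n)).pow_const 2) fun w => ?_) _
        rw [abs_pow]
        exact pow_le_pow_left₀ (abs_nonneg _) (abs_cutoff_le (Nat.cast_nonneg n) _) 2
      have i12 : Integrable (fun w => S n w ^ 2 + 2 * (S n w * (cutoff n (ξ n w) / n))) P :=
        i1.add i2
      simp_rw [h1]
      rw [integral_add i12 i3, integral_add i1 i2, integral_const_mul, h2, ih,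
        integral_const_mul, Finset.sum_range_succ]
      ring
  set ℱ := Filtration.natural ξ fun n => (hm n).stronglyMeasurable with hℱ
  -- The index is shifted because `S (n + 1)` involves exactly `ξ 0, …, ξ n`, the variables that
  -- generate `ℱ n`.
  have hmart : Martingale (fun n => S (n + 1)) ℱ P := by
    refine martingale_of_setIntegral_eq_succ (fun n => ?_) (fun n => hSi _) fun n s hs => ?_
    · refine Measurable.stronglyMeasurable ?_
      refine Finset.measurable_sum _ fun i hi => ((measurable_cutoff _).comp ?_).div_const _
      exact ((Filtration.stronglyAdapted_natural fun n => (hm n).stronglyMeasurable) i).measurable.mono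
        (ℱ.mono (Nat.lt_succ_iff.1 (Finset.mem_range.1 hi))) le_rfl
    · have hs' : MeasurableSet s := ℱ.le n s hs
      rw [hℱ, Filtration.natural_eq_comap] at hs
      obtain ⟨A, hA, rfl⟩ := hs
      -- An event of `ℱ n` is a preimage under `(ξ 0, …, ξ n)`, so its indicator is a function of
      -- these variables.
      have hΦ : Measurable fun y : Fin (n + 1) → ℝ => Set.indicator A (fun _ => (1 : ℝ))
          (fun j : Set.Iic n => y ⟨j, Nat.lt_succ_iff.2 j.2⟩) :=
        (measurable_const.indicator hA).comp
          (measurable_pi_lambda _ fun j => measurable_pi_apply _)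
      have h0 := integral_mul_odd_eq_zero hrefl hΦ ((measurable_cutoff (n + 1 : ℕ)).div_const
        ((n + 1 : ℕ) : ℝ)) fun x => by rw [cutoff_neg, neg_div]
      have h1 : ∫ w in (fun w (j : Set.Iic n) => ξ j w) ⁻¹' A,
          cutoff (n + 1 : ℕ) (ξ (n + 1) w) / (n + 1 : ℕ) ∂P = 0 := by
        rw [← integral_indicator hs', ← h0]
        refine integral_congr_ae (Eventually.of_forall fun w => ?_)
        by_cases hw : (fun j : Set.Iic n => ξ j w) ∈ A <;> simp [Set.indicator, hw]
      have h2 : ∀ w, S (n + 1 + 1) w = S (n + 1) w + cutoff (n + 1 : ℕ) (ξ (n + 1) w) /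
          (n + 1 : ℕ) := fun w => Finset.sum_range_succ _ _
      simp_rw [h2]
      rw [integral_add (hSi _).integrableOn
        (hbdd 1 (hZm (n + 1)) (hZb (n + 1))).integrableOn, h1, add_zero]
  have hlim := hmart.submartingale.exists_ae_tendsto_of_bdd
    (R := Real.toNNReal (1 + 2 * ∫ w, |ξ 0 w| ∂P)) fun n => by
      rw [eLpNorm_one_eq_lintegral_enorm, ← ofReal_integral_norm_eq_lintegral_enorm (hSi _)]
      refine ENNReal.ofReal_le_ofReal ?_
      have i1 : Integrable (fun w => S (n + 1) w ^ 2) P :=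
        hbdd (((n + 1 : ℕ) : ℝ) ^ 2) ((hSm _).pow_const 2) fun w => by
          rw [abs_pow]
          exact pow_le_pow_left₀ (abs_nonneg _) (hSb _ w) 2
      -- The bound `|s| ≤ 1 + s²` passes from second moments to the `L¹` bound.
      calc ∫ w, ‖S (n + 1) w‖ ∂P ≤ ∫ w, (1 + S (n + 1) w ^ 2) ∂P := by
            refine integral_mono (hSi _).norm ((integrable_const 1).add i1) fun w => ?_
            simp only [Real.norm_eq_abs]
            nlinarith [sq_abs (S (n + 1) w), sq_nonneg (|S (n + 1) w| - 1)]
        _ = 1 + ∫ w, S (n + 1) w ^ 2 ∂P := by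
            rw [integral_add (integrable_const 1) i1]
            simp
        _ ≤ _ := by
            rw [hS2]
            exact add_le_add_right (integral_cutoff_sq_le hint hident _) _
  filter_upwards [hlim] with w ⟨c, hc⟩
  exact ⟨c, (tendsto_add_atTop_iff_nat (f := fun n => S n w) 1).1 hc⟩

/-- The strong law of large numbers for a sequence of identically distributed integrable random
variables whose finite-dimensional laws are invariant under a change of the last sign. -/
theorem strong_law_of_reflection (hm : ∀ n, Measurable (ξ n)) (hint : Integrable (ξ 0) P)
    (hident : ∀ n, ProbabilityTheory.IdentDistrib (ξ n) (ξ 0) P P)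
    (hrefl : ∀ n : ℕ, ProbabilityTheory.IdentDistrib (fun w (m : Fin (n + 1)) => ξ m w)
      (fun w m => if m = Fin.last n then -ξ m w else ξ m w) P P) :
    ∀ᵐ w ∂P, Tendsto (fun n : ℕ => (n : ℝ)⁻¹ * ∑ i ∈ Finset.range n, ξ i w) atTop (𝓝 0) := by
  filter_upwards [exists_tendsto_sum_cutoff_div hm hint hident hrefl,
    ae_eventually_cutoff_eq_self hint hident] with w ⟨c, hc⟩ hw
  have h0 : cutoff ((0 : ℕ) : ℝ) (ξ 0 w) = 0 := by
    have := abs_cutoff_le (A := ((0 : ℕ) : ℝ)) (by simp) (ξ 0 w)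
    simpa using this
  have h1 := tendsto_average_of_tendsto_sum_div (a := fun i => cutoff (i : ℕ) (ξ i w)) h0 hc
  have h2 : Tendsto (fun n : ℕ => ξ n w - cutoff n (ξ n w)) atTop (𝓝 0) := by
    refine tendsto_const_nhds.congr' ?_
    filter_upwards [hw] with n hn
    rw [hn, sub_self]
  have h3 := h1.add h2.cesaro
  rw [add_zero] at h3
  refine h3.congr fun n => ?_
  rw [← mul_add, ← Finset.sum_add_distrib]
  congr 1
  exact Finset.sum_congr rfl fun i _ => by ring

end StrongLaw

/-! ### The manifold of `q`-Gaussians -/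

/-- Topology and smooth structure are transported along `Φ`. With a singleton atlas every preferred
chart is `φ` by definition. -/
theorem exists_globalChart {n : ℕ} {M : Type*} (Φ : M ≃ EuclideanSpace ℝ (Fin n)) :
    ∃ (_ : TopologicalSpace M) (_ : ChartedSpace (EuclideanSpace ℝ (Fin n)) M)
      (_ : IsManifold (𝓡 n) ∞ M) (φ : M ≃ₜ EuclideanSpace ℝ (Fin n)),
      (∀ p, φ p = Φ p) ∧
        ∀ p : M, chartAt (EuclideanSpace ℝ (Fin n)) p = φ.toOpenPartialHomeomorph := by
  let t : TopologicalSpace M := TopologicalSpace.induced Φ inferInstance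
  let φ : M ≃ₜ EuclideanSpace ℝ (Fin n) := Φ.toHomeomorphOfIsInducing ⟨rfl⟩
  let ch := φ.toOpenPartialHomeomorph.singletonChartedSpace rfl
  exact ⟨t, ch, φ.toOpenPartialHomeomorph.isManifold_singleton rfl, φ, fun _ => rfl, fun _ => rfl⟩

/-- The bilinear form `a ⟪x, y⟫`. -/
noncomputable def innerForm {F : Type*} [NormedAddCommGroup F] [InnerProductSpace ℝ F] (a : ℝ) :
    F →L[ℝ] F →L[ℝ] ℝ :=
  a • innerSL ℝ

@[simp]
theorem innerForm_apply {F : Type*} [NormedAddCommGroup F] [InnerProductSpace ℝ F] (a : ℝ)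
    (x y : F) : innerForm a x y = a * inner ℝ x y :=
  rfl

section QGaussian

variable {d : ℕ} {q : ℝ}

/-- The threshold at which `|x|^(-2/(q-1))` becomes integrable at infinity in dimension `d`. -/
theorem one_div_sub_pos (hq1 : 1 < q) (hdq : (d : ℝ) * (q - 1) < 2) :
    (d : ℝ) / 2 < 1 / (q - 1) := by
  rw [lt_div_iff₀ (by linarith)]
  linarith

theorem qGaussianConst_pos (hq1 : 1 < q) (hdq : (d : ℝ) * (q - 1) < 2) :
    0 < qGaussianConst q d := by
  have h1 : 0 < q - 1 := by linarith
  have h2 := Real.Gamma_pos_of_pos (sub_pos.2 (one_div_sub_pos hq1 hdq))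
  have h3 := Real.Gamma_pos_of_pos (one_div_pos.2 h1)
  have h4 := Real.pi_pos
  unfold qGaussianConst
  positivity

theorem qGaussian_base_pos (hq1 : 1 < q) (hdq : (d : ℝ) * (q - 1) < 2)
    (v x : EuclideanSpace ℝ (Fin d)) : 0 < (q - 1) * ‖x - v‖ ^ 2 + qGaussianConst q d :=
  add_pos_of_nonneg_of_pos (mul_nonneg (by linarith) (sq_nonneg _)) (qGaussianConst_pos hq1 hdq)

theorem qGaussian_pos (hq1 : 1 < q) (hdq : (d : ℝ) * (q - 1) < 2)
    (v x : EuclideanSpace ℝ (Fin d)) : 0 < qGaussian q d v x :=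
  Real.rpow_pos_of_pos (qGaussian_base_pos hq1 hdq v x) _

theorem ell_qGaussian (hq1 : 1 < q) (hdq : (d : ℝ) * (q - 1) < 2)
    (v x : EuclideanSpace ℝ (Fin d)) :
    ell (hq q) id (qGaussian q d v x) = -‖x - v‖ ^ 2 - (qGaussianConst q d - 1) / (q - 1) := by
  rw [qGaussian, ell_hq_rpow hq1.ne' (qGaussian_base_pos hq1 hdq v x)]
  have h1 : q - 1 ≠ 0 := by linarith
  have h2 : 1 - q ≠ 0 := by linarith
  field_simp
  ring

theorem qGaussian_injective (hq1 : 1 < q) (hdq : (d : ℝ) * (q - 1) < 2) :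
    Function.Injective (qGaussian q d) := by
  intro v v' h
  have h1 := ell_qGaussian hq1 hdq v v
  rw [h, ell_qGaussian hq1 hdq v' v, sub_self, norm_zero] at h1
  have h2 : ‖v - v'‖ ^ 2 = 0 := by linarith
  exact sub_eq_zero.1 (norm_eq_zero.1 (pow_eq_zero_iff two_ne_zero |>.1 h2))

theorem qGaussian_eq_radial (v x : EuclideanSpace ℝ (Fin d)) :
    qGaussian q d v x = radial (innerForm (q - 1)) 1 (qGaussianConst q d) (1 / (q - 1))
      (x - ContinuousLinearMap.id ℝ _ v) := by
  rw [radial, qGaussian, one_mul]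
  simp only [innerForm_apply, real_inner_self_eq_norm_sq, ContinuousLinearMap.id_apply]
  rw [add_comm, ← one_div_neg_eq_neg_one_div, neg_sub]

theorem integral_radial_qGaussian (hq1 : 1 < q) (hdq : (d : ℝ) * (q - 1) < 2) :
    Integrable (radial (innerForm (F := EuclideanSpace ℝ (Fin d)) (q - 1)) 1
        (qGaussianConst q d) (1 / (q - 1))) ∧
      ∫ x, radial (innerForm (F := EuclideanSpace ℝ (Fin d)) (q - 1)) 1
        (qGaussianConst q d) (1 / (q - 1)) x = 1 := by
  have h1 : 0 < q - 1 := by linarith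
  have h2 := one_div_sub_pos hq1 hdq
  have h3 := integral_add_norm_sq_rpow_neg (d := d) h1 (qGaussianConst_pos hq1 hdq)
    (one_div_pos.2 h1) h2
  have h4 : radial (innerForm (F := EuclideanSpace ℝ (Fin d)) (q - 1)) 1
      (qGaussianConst q d) (1 / (q - 1)) =
      fun x => (qGaussianConst q d + (q - 1) * ‖x‖ ^ 2) ^ (-(1 / (q - 1))) := by
    ext x
    simp [radial]
  rw [h4]
  refine ⟨h3.1, h3.2.trans ?_⟩
  have hΓ1 := Real.Gamma_pos_of_pos (sub_pos.2 h2)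
  have hΓ2 := Real.Gamma_pos_of_pos (one_div_pos.2 h1)
  have hpi := Real.pi_pos
  have hd2 : 2 - (d : ℝ) * (q - 1) ≠ 0 := by linarith
  -- The outer exponent in the constant is the reciprocal of `d/2 - 1/(q-1)`, the power with which
  -- the constant enters the integral, so the product of the two exponents is `1`.
  rw [qGaussianConst, ← Real.rpow_mul (by positivity),
    show 2 * (1 - q) / (2 - d * (q - 1)) * ((d : ℝ) / 2 - 1 / (q - 1)) = 1 by
      field_simp
      ring,
    Real.rpow_one, show Real.pi / (q - 1) = ((q - 1) / Real.pi)⁻¹ by rw [inv_div],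
    Real.inv_rpow (by positivity)]
  have h5 : 0 < ((q - 1) / Real.pi) ^ ((d : ℝ) / 2) := by positivity
  generalize Real.Gamma (1 / (q - 1) - (d : ℝ) / 2) = γ at *
  field_simp

variable {M : Type*} [TopologicalSpace M] [ChartedSpace (EuclideanSpace ℝ (Fin d)) M]
  [IsManifold (𝓡 d) ∞ M] {φ : M ≃ₜ EuclideanSpace ℝ (Fin d)}
  {e : M → EuclideanSpace ℝ (Fin d) → ℝ}

theorem isStatisticalModel_qGaussian
    (hφ : ∀ p : M, chartAt (EuclideanSpace ℝ (Fin d)) p = φ.toOpenPartialHomeomorph)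
    (hq1 : 1 < q) (hdq : (d : ℝ) * (q - 1) < 2) (he : ∀ p, e p = qGaussian q d (φ p)) :
    IsStatisticalModel volume d e := by
  have h1 : 0 < q - 1 := by linarith
  refine isStatisticalModel_radial (B := innerForm (q - 1)) (J := ContinuousLinearMap.id ℝ _)
    (K := 1) (C := qGaussianConst q d) (s := 1 / (q - 1)) (κ := q - 1) hφ one_pos
    (qGaussianConst_pos hq1 hdq) (one_div_pos.2 h1) (fun y => ?_) (fun y z => ?_) h1
    (fun v w => ?_) (integral_radial_qGaussian hq1 hdq).1 (integral_radial_qGaussian hq1 hdq).2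
    fun p x => ?_
  · rw [innerForm_apply]
    exact mul_nonneg h1.le real_inner_self_nonneg
  · simp [real_inner_comm]
  · simp
  · rw [he, qGaussian_eq_radial]

theorem exists_isGlobalExpCoordRep_qGaussian
    (hφ : ∀ p : M, chartAt (EuclideanSpace ℝ (Fin d)) p = φ.toOpenPartialHomeomorph)
    (hq1 : 1 < q) (hdq : (d : ℝ) * (q - 1) < 2) (he : ∀ p, e p = qGaussian q d (φ p)) :
    ∃ θ T c ψ, IsGlobalExpCoordRep (n := d) (hq q) id (Set.Ioi 0) e θ T c ψ := by
  -- Read off from `-|x-v|² = ⟨v, 2x⟩ - |x|² - |v|²`.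
  refine ⟨φ.toOpenPartialHomeomorph, fun x => (2 : ℝ) • x, fun x => ‖x‖ ^ 2,
    fun p => ‖φ p‖ ^ 2 + (qGaussianConst q d - 1) / (q - 1),
    { chart := ?_
      continuous_T := by fun_prop
      continuous_c := by fun_prop
      smooth_psi := ?_
      eq_exp := fun p _ x => ?_
      source_eq := rfl }⟩
  · rw [← hφ (φ.symm 0)]
    exact IsManifold.chart_mem_maximalAtlas _
  · refine (contMDiff_of_contDiff hφ ?_).contMDiffOn
    simp_rw [φ.apply_symm_apply]
    exact (contDiff_norm_sq ℝ).add contDiff_const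
  · rw [← deformedExp_ell hq1.ne' (he p ▸ qGaussian_pos hq1 hdq (φ p) x : 0 < e p x), he,
      ell_qGaussian hq1 hdq]
    congr 1
    rw [norm_sub_sq_real, Homeomorph.toOpenPartialHomeomorph_apply, inner_smul_right,
      real_inner_comm]
    ring

theorem isExpFamily_qGaussian
    (hφ : ∀ p : M, chartAt (EuclideanSpace ℝ (Fin d)) p = φ.toOpenPartialHomeomorph)
    (hq1 : 1 < q) (hdq : (d : ℝ) * (q - 1) < 2) (he : ∀ p, e p = qGaussian q d (φ p)) :
    IsExpFamily (hq q) id (Set.Ioi 0) volume d e where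
  gauge := isGauge_hq hq1.ne'
  density := (isStatisticalModel_qGaussian hφ hq1 hdq he).density
  model := isStatisticalModel_qGaussian hφ hq1 hdq he
  exists_rep p := by
    obtain ⟨θ, T, c, ψ, h⟩ := exists_isGlobalExpCoordRep_qGaussian hφ hq1 hdq he
    exact ⟨θ, T, c, ψ, h.source_eq ▸ Set.mem_univ p, h.toIsExpCoordRep⟩

/-! ### Arbitrary global coordinate representations -/

variable {θ : OpenPartialHomeomorph M (EuclideanSpace ℝ (Fin d))}
  {T : EuclideanSpace ℝ (Fin d) → EuclideanSpace ℝ (Fin d)} {c : EuclideanSpace ℝ (Fin d) → ℝ}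
  {ψ : M → ℝ}

omit [IsManifold (𝓡 d) ∞ M] in
theorem IsGlobalExpCoordRep.inner_sub_eq (hq1 : 1 < q) (hdq : (d : ℝ) * (q - 1) < 2)
    (he : ∀ p, e p = qGaussian q d (φ p))
    (h : IsGlobalExpCoordRep (n := d) (hq q) id (Set.Ioi 0) e θ T c ψ) (p : M)
    (x : EuclideanSpace ℝ (Fin d)) :
    inner ℝ (θ p) (T x) - c x =
      ψ p - (qGaussianConst q d - 1) / (q - 1) - ‖x - φ p‖ ^ 2 := by
  have h1 := eq_ell_of_deformedExp_eq hq1 (h.eq_exp p (h.source_eq ▸ Set.mem_univ p) x).symm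
  rw [he, ell_qGaussian hq1 hdq] at h1
  linarith

omit [IsManifold (𝓡 d) ∞ M] in
-- The image of the chart is open, so it contains `θ p₀ + t u` for some small `t > 0`. Subtracting
-- `IsGlobalExpCoordRep.inner_sub_eq` at the two points cancels `c` and `|x|²` and leaves `t ⟨u,
-- T(x)⟩` as an affine function of `x`.
theorem IsGlobalExpCoordRep.exists_inner_eq (hq1 : 1 < q) (hdq : (d : ℝ) * (q - 1) < 2)
    (he : ∀ p, e p = qGaussian q d (φ p))
    (h : IsGlobalExpCoordRep (n := d) (hq q) id (Set.Ioi 0) e θ T c ψ)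
    (u : EuclideanSpace ℝ (Fin d)) :
    ∃ (w : EuclideanSpace ℝ (Fin d)) (b : ℝ), ∀ x, inner ℝ u (T x) = inner ℝ w x + b := by
  set p₀ : M := φ.symm 0
  have hp₀ : θ p₀ ∈ θ.target := θ.map_source (h.source_eq ▸ Set.mem_univ p₀)
  have hcont : Tendsto (fun t : ℝ => θ p₀ + t • u) (𝓝[>] 0) (𝓝 (θ p₀)) := by
    have : Continuous fun t : ℝ => θ p₀ + t • u := by fun_prop
    have h2 := this.tendsto 0
    rw [zero_smul, add_zero] at h2
    exact h2.mono_left nhdsWithin_le_nhds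
  obtain ⟨t, ht, ht0⟩ := ((hcont.eventually (θ.open_target.mem_nhds hp₀)).and self_mem_nhdsWithin).exists
  have ht0 : 0 < t := ht0
  have hp := θ.right_inv ht
  set p := θ.symm (θ p₀ + t • u)
  refine ⟨(2 / t) • (φ p - φ p₀), (ψ p - ψ p₀ - ‖φ p‖ ^ 2 + ‖φ p₀‖ ^ 2) / t, fun x => ?_⟩
  have h1 := h.inner_sub_eq hq1 hdq he p x
  have h2 := h.inner_sub_eq hq1 hdq he p₀ x
  rw [hp, inner_add_left, real_inner_smul_left, norm_sub_sq_real] at h1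
  rw [norm_sub_sq_real] at h2
  rw [real_inner_smul_left, inner_sub_left, real_inner_comm x, real_inner_comm x]
  field_simp
  linarith

omit [IsManifold (𝓡 d) ∞ M] in
theorem IsGlobalExpCoordRep.reflect (hq1 : 1 < q) (hdq : (d : ℝ) * (q - 1) < 2)
    (he : ∀ p, e p = qGaussian q d (φ p))
    (h : IsGlobalExpCoordRep (n := d) (hq q) id (Set.Ioi 0) e θ T c ψ)
    (v x : EuclideanSpace ℝ (Fin d)) : T (v + v - x) = T v + T v - T x := by
  refine ext_inner_left ℝ fun u => ?_
  obtain ⟨w, b, hw⟩ := h.exists_inner_eq hq1 hdq he u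
  rw [hw, inner_sub_right, inner_sub_right, inner_add_right, inner_add_right, hw, hw]
  ring

end QGaussian

/-! ### A repetition of the family of `q`-Gaussians by multivariate Student distributions -/

section Student

/-- The bilinear form `a ∑ ⟪x m, y m⟫`. -/
noncomputable def sumForm (d : ℕ) (a : ℝ) (k : ℕ) :
    (Fin k → EuclideanSpace ℝ (Fin d)) →L[ℝ] (Fin k → EuclideanSpace ℝ (Fin d)) →L[ℝ] ℝ :=
  ∑ m : Fin k, (innerForm a).bilinearComp
    (ContinuousLinearMap.proj (R := ℝ) (φ := fun _ : Fin k => EuclideanSpace ℝ (Fin d)) m)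
    (ContinuousLinearMap.proj (R := ℝ) (φ := fun _ : Fin k => EuclideanSpace ℝ (Fin d)) m)

variable {d : ℕ}

theorem sumForm_apply (a : ℝ) (k : ℕ) (x y : Fin k → EuclideanSpace ℝ (Fin d)) :
    sumForm d a k x y = a * ∑ m, inner ℝ (x m) (y m) := by
  simp [sumForm, Finset.mul_sum, sum_apply]

/-- The diagonal embedding. -/
noncomputable def diag (d k : ℕ) :
    EuclideanSpace ℝ (Fin d) →L[ℝ] (Fin k → EuclideanSpace ℝ (Fin d)) :=
  ContinuousLinearMap.pi fun _ => ContinuousLinearMap.id ℝ _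

@[simp]
theorem diag_apply (k : ℕ) (v : EuclideanSpace ℝ (Fin d)) (m : Fin k) : diag d k v m = v := rfl

/-- The exponent of the Student density on `(ℝ^d)^k` with four degrees of freedom. -/
noncomputable def studentExponent (d k : ℕ) : ℝ := 2 + (d : ℝ) * k / 2

/-- The normalizing constant of the Student density. -/
noncomputable def studentConst (a C : ℝ) (d k : ℕ) : ℝ :=
  (Real.pi / a) ^ (-((d : ℝ) * k / 2)) * Real.Gamma (studentExponent d k) * C ^ (2 : ℝ)

/-- The Student density on `(ℝ^d)^k` with location `(v, …, v)`. -/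
noncomputable def studentDensity (a C : ℝ) (k : ℕ) (v : EuclideanSpace ℝ (Fin d))
    (x : Fin k → EuclideanSpace ℝ (Fin d)) : ℝ :=
  radial (sumForm d a k) (studentConst a C d k) C (studentExponent d k) (x - diag d k v)

theorem studentExponent_pos (d k : ℕ) : 0 < studentExponent d k := by
  unfold studentExponent
  positivity

variable {a C : ℝ}

theorem studentConst_pos (ha : 0 < a) (hC : 0 < C) (k : ℕ) : 0 < studentConst a C d k := by
  have h1 := Real.Gamma_pos_of_pos (studentExponent_pos d k)
  have h2 := Real.pi_pos
  unfold studentConst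
  positivity

theorem radial_sumForm (K s : ℝ) (k : ℕ) (y : Fin k → EuclideanSpace ℝ (Fin d)) :
    radial (sumForm d a k) K C s y = K * (C + a * ∑ m, ‖y m‖ ^ 2) ^ (-s) := by
  simp_rw [radial, sumForm_apply, real_inner_self_eq_norm_sq]

theorem studentDensity_eq (k : ℕ) (v : EuclideanSpace ℝ (Fin d))
    (x : Fin k → EuclideanSpace ℝ (Fin d)) :
    studentDensity a C k v x =
      studentConst a C d k * (C + a * ∑ m, ‖x m - v‖ ^ 2) ^ (-studentExponent d k) := by
  rw [studentDensity, radial_sumForm]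
  rfl

theorem sumForm_self_nonneg (ha : 0 < a) (k : ℕ) (y : Fin k → EuclideanSpace ℝ (Fin d)) :
    0 ≤ sumForm d a k y y := by
  simp_rw [sumForm_apply, real_inner_self_eq_norm_sq]
  positivity

theorem integral_radial_student (ha : 0 < a) (hC : 0 < C) (k : ℕ) :
    Integrable (radial (sumForm d a k) (studentConst a C d k) C (studentExponent d k))
        (prodMeasure volume k) ∧
      ∫ x, radial (sumForm d a k) (studentConst a C d k) C (studentExponent d k) x
        ∂(prodMeasure volume k) = 1 := by
  have h := integral_add_sum_norm_sq_rpow_neg (d := d) k ha hC (studentExponent_pos d k)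
    (by unfold studentExponent; linarith)
  simp_rw [funext (radial_sumForm (a := a) (C := C) (studentConst a C d k) (studentExponent d k) k)]
  refine ⟨h.1.const_mul _, ?_⟩
  rw [integral_const_mul, h.2, studentConst]
  have h1 := Real.Gamma_pos_of_pos (studentExponent_pos d k)
  have hpi := Real.pi_pos
  have h2 : studentExponent d k - (d : ℝ) * k / 2 = 2 := by unfold studentExponent; ring
  have h3 : (d : ℝ) * k / 2 - studentExponent d k = -2 := by unfold studentExponent; ring
  -- With four degrees of freedom the remaining Gamma factor is `Γ(2) = 1`, for every `k`.
  rw [h2, h3, Real.Gamma_two, Real.rpow_neg hC.le, Real.rpow_neg (by positivity)]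
  have h4 : 0 < (Real.pi / a) ^ ((d : ℝ) * k / 2) := by positivity
  have h5 : 0 < C ^ (2 : ℝ) := by positivity
  field_simp

theorem isDensity_student (ha : 0 < a) (hC : 0 < C) (k : ℕ) (v : EuclideanSpace ℝ (Fin d)) :
    IsDensity (prodMeasure volume k) (Set.Ioi 0) (studentDensity a C k v) :=
  isDensity_radial_translate (studentConst_pos ha hC k) hC (sumForm_self_nonneg ha k)
    (integral_radial_student ha hC k).1 (integral_radial_student ha hC k).2 _

/-- The terms of `x` only enlarge the additive constant from `C` to `A`. Integrating over the other
`k'` vectors then lowers the exponent by `dk'/2`, which is exactly the difference of the exponents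
for `k + k'` and `k`. -/
theorem integral_studentDensity_append (ha : 0 < a) (hC : 0 < C) (k k' : ℕ)
    (v : EuclideanSpace ℝ (Fin d)) (x : Fin k → EuclideanSpace ℝ (Fin d)) :
    ∫ y, studentDensity a C (k + k') v (Fin.append x y) ∂(prodMeasure volume k') =
      studentDensity a C k v x := by
  have hA : 0 < C + a * ∑ m, ‖x m - v‖ ^ 2 := by positivity
  set A := C + a * ∑ m, ‖x m - v‖ ^ 2 with hAdef
  have h0 : ∀ y : Fin k' → EuclideanSpace ℝ (Fin d),
      studentDensity a C (k + k') v (Fin.append x y) = studentConst a C d (k + k') *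
        (fun y : Fin k' → EuclideanSpace ℝ (Fin d) =>
          (A + a * ∑ m, ‖y m‖ ^ 2) ^ (-studentExponent d (k + k'))) (y - diag d k' v) := by
    intro y
    rw [studentDensity_eq, Fin.sum_univ_add]
    simp only [Fin.append_left, Fin.append_right, Pi.sub_apply, diag_apply, hAdef, mul_add,
      add_assoc]
  have h := (integral_add_sum_norm_sq_rpow_neg (d := d) k' ha hA (studentExponent_pos d (k + k'))
    (by
      have : 0 ≤ (d : ℝ) * k := by positivity
      unfold studentExponent
      push_cast
      linarith)).2
  simp_rw [h0]
  rw [integral_const_mul, integral_sub_right_eq_self (fun y : Fin k' → EuclideanSpace ℝ (Fin d) =>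
    (A + a * ∑ m, ‖y m‖ ^ 2) ^ (-studentExponent d (k + k'))), h, studentDensity_eq]
  have h1 := Real.Gamma_pos_of_pos (studentExponent_pos d (k + k'))
  have hpi := Real.pi_pos
  have h2 : studentExponent d (k + k') - (d : ℝ) * k' / 2 = studentExponent d k := by
    unfold studentExponent; push_cast; ring
  have h3 : (d : ℝ) * k' / 2 - studentExponent d (k + k') = -studentExponent d k := by
    rw [← h2]; ring
  rw [h2, h3, studentConst, studentConst,
    show -((d : ℝ) * (k + k' : ℕ) / 2) = -((d : ℝ) * k / 2) + -((d : ℝ) * k' / 2) by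
      push_cast; ring, Real.rpow_add (by positivity), Real.rpow_neg (by positivity) ((d : ℝ) * k' / 2)]
  have h4 : 0 < (Real.pi / a) ^ ((d : ℝ) * k' / 2) := by positivity
  field_simp
  rw [hAdef]

theorem studentDensity_injective (ha : 0 < a) (hC : 0 < C) {k : ℕ} (hk : 1 ≤ k) :
    Function.Injective (studentDensity (d := d) a C k) := by
  intro v v' h
  have h1 := congrFun h (diag d k v)
  have hs := studentExponent_pos d k
  have h2 := form_eq_of_radial (studentConst_pos (d := d) ha hC k) hC hs
    (sumForm_self_nonneg ha k) (diag d k v - diag d k v')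
  rw [← studentDensity, ← h1, studentDensity, ← form_eq_of_radial (studentConst_pos ha hC k) hC hs
    (sumForm_self_nonneg ha k), sub_self, map_zero, sumForm_apply, mul_eq_zero] at h2
  have h3 := h2.resolve_left ha.ne'
  simp only [Pi.sub_apply, diag_apply, Finset.sum_const, Finset.card_univ, Fintype.card_fin,
    nsmul_eq_mul, mul_eq_zero, Nat.cast_eq_zero, inner_self_eq_zero] at h3
  exact sub_eq_zero.1 (h3.resolve_left (by omega))

theorem isStatisticalModelSet_student {M : Type*} (φ : M ≃ EuclideanSpace ℝ (Fin d)) (ha : 0 < a)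
    (hC : 0 < C) {k : ℕ} (hk : 1 ≤ k) :
    IsStatisticalModelSet (prodMeasure volume k)
      (Set.range fun p : M => studentDensity a C k (φ p)) := by
  have hinj : Function.Injective fun p : M => studentDensity a C k (φ p) :=
    (studentDensity_injective ha hC hk).comp φ.injective
  obtain ⟨t, ch, hman, Φ, hΦ, hchart⟩ :=
    exists_globalChart ((Equiv.ofInjective _ hinj).symm.trans φ)
  refine ⟨d, t, ch, hman, ?_⟩
  have hk0 : (0 : ℝ) < k := by exact_mod_cast hk
  refine isStatisticalModel_radial (κ := a * k) hchart (studentConst_pos ha hC k) hC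
    (studentExponent_pos d k) (sumForm_self_nonneg ha k) (fun y z => ?_) (by positivity)
    (J := diag d k) (fun v w => ?_) (integral_radial_student ha hC k).1
    (integral_radial_student ha hC k).2 fun S x => ?_
  · simp_rw [sumForm_apply, real_inner_comm]
  · simp [sumForm_apply, mul_assoc]
  · obtain ⟨p, rfl⟩ := (Equiv.ofInjective _ hinj).surjective S
    rw [hΦ, Equiv.trans_apply, Equiv.symm_apply_apply]
    rfl

/-- An affine function is at most `D (C + a|x-v|²)`. This costs one unit of the exponent `2 + d/2`,
and `1 + d/2` still exceeds the threshold `d/2`. -/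
theorem integrable_studentDensity_one_mul (ha : 0 < a) (hC : 0 < C)
    (v w : EuclideanSpace ℝ (Fin d)) (b : ℝ) :
    Integrable fun x => studentDensity a C 1 v (fun _ => x) * (inner ℝ w x + b) := by
  have h1 := (integral_add_norm_sq_rpow_neg (d := d) ha hC
    (show 0 < 1 + (d : ℝ) / 2 by positivity) (by linarith)).1.comp_sub_right v
  set D : ℝ := (‖w‖ + |inner ℝ w v + b|) * (1 / C + 1 + 1 / a) with hD
  refine (h1.const_mul (studentConst a C d 1 * D)).mono' ?_ (Eventually.of_forall fun x => ?_)
  · refine Continuous.aestronglyMeasurable ?_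
    simp_rw [studentDensity_eq]
    refine (continuous_const.mul (Continuous.rpow_const (by fun_prop) fun x => Or.inl ?_)).mul
      (by fun_prop)
    positivity
  · have hz : 0 < C + a * ‖x - v‖ ^ 2 := by positivity
    have hK := studentConst_pos (d := d) ha hC 1
    have h2 : |inner ℝ w x + b| ≤ D * (C + a * ‖x - v‖ ^ 2) := by
      have e1 : inner ℝ w x + b = inner ℝ w (x - v) + (inner ℝ w v + b) := by
        rw [inner_sub_right]; ring
      have e2 : ‖x - v‖ ≤ 1 + ‖x - v‖ ^ 2 := by nlinarith [sq_nonneg (‖x - v‖ - 1)]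
      have e3 : 1 + ‖x - v‖ ^ 2 ≤ (1 / C + 1 + 1 / a) * (C + a * ‖x - v‖ ^ 2) := by
        have : (1 / C + 1 + 1 / a) * (C + a * ‖x - v‖ ^ 2) = 1 + ‖x - v‖ ^ 2 +
            (a * ‖x - v‖ ^ 2 / C + C + a * ‖x - v‖ ^ 2 + C / a) := by
          field_simp
          ring
        have : 0 ≤ a * ‖x - v‖ ^ 2 / C + C + a * ‖x - v‖ ^ 2 + C / a := by positivity
        linarith
      calc |inner ℝ w x + b| ≤ ‖w‖ * ‖x - v‖ + |inner ℝ w v + b| := by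
            rw [e1]
            exact (abs_add_le _ _).trans (add_le_add_left (abs_real_inner_le_norm _ _) _)
        _ ≤ ‖w‖ * (1 + ‖x - v‖ ^ 2) + |inner ℝ w v + b| * (1 + ‖x - v‖ ^ 2) := by
            refine add_le_add (mul_le_mul_of_nonneg_left e2 (norm_nonneg _))
              (le_mul_of_one_le_right (abs_nonneg _) ?_)
            nlinarith [sq_nonneg ‖x - v‖]
        _ = (‖w‖ + |inner ℝ w v + b|) * (1 + ‖x - v‖ ^ 2) := by ring
        _ ≤ (‖w‖ + |inner ℝ w v + b|) *
              ((1 / C + 1 + 1 / a) * (C + a * ‖x - v‖ ^ 2)) :=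
            mul_le_mul_of_nonneg_left e3 (by positivity)
        _ = D * (C + a * ‖x - v‖ ^ 2) := by rw [hD]; ring
    have h3 : (C + a * ‖x - v‖ ^ 2) ^ (-(1 + (d : ℝ) / 2)) =
        (C + a * ‖x - v‖ ^ 2) ^ (-studentExponent d 1) * (C + a * ‖x - v‖ ^ 2) := by
      rw [← Real.rpow_add_one hz.ne', studentExponent]
      congr 1
      push_cast
      ring
    have h4 : 0 ≤ (C + a * ‖x - v‖ ^ 2) ^ (-studentExponent d 1) := Real.rpow_nonneg hz.le _
    rw [Real.norm_eq_abs, abs_mul, studentDensity_eq, Fin.sum_univ_one,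
      abs_of_nonneg (mul_nonneg hK.le h4), h3]
    calc _ ≤ studentConst a C d 1 * (C + a * ‖x - v‖ ^ 2) ^ (-studentExponent d 1) *
          (D * (C + a * ‖x - v‖ ^ 2)) := mul_le_mul_of_nonneg_left h2 (mul_nonneg hK.le h4)
      _ = _ := by ring

end Student

/-! ### The Student densities form a repetition -/

section Repetition

variable {d : ℕ} {q : ℝ} {M : Type*} [TopologicalSpace M]
  [ChartedSpace (EuclideanSpace ℝ (Fin d)) M] {φ : M ≃ₜ EuclideanSpace ℝ (Fin d)}
  {e : M → EuclideanSpace ℝ (Fin d) → ℝ}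

theorem isRepetition_student (hq1 : 1 < q) (hdq : (d : ℝ) * (q - 1) < 2)
    (he : ∀ p, e p = qGaussian q d (φ p)) :
    IsRepetition (n := d) (hq q) id (Set.Ioi 0) volume e
      (fun k p => studentDensity (q - 1) (qGaussianConst q d) k (φ p)) where
  density k _ p := isDensity_student (by linarith) (qGaussianConst_pos hq1 hdq) k _
  injective k hk := (studentDensity_injective (by linarith) (qGaussianConst_pos hq1 hdq) hk).comp
    φ.injective
  model k hk := isStatisticalModelSet_student φ.toEquiv (by linarith)
    (qGaussianConst_pos hq1 hdq) hk
  formula k hk := by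
    have h1 : 0 < q - 1 := by linarith
    have hC := qGaussianConst_pos hq1 hdq
    have hK := studentConst_pos (d := d) h1 hC k
    have hs := studentExponent_pos d k
    set C := qGaussianConst q d with hCdef
    -- The `q`-exponential is `z^(1/(1-q))` with `z = C + (q-1) ∑ |x_m - v|²`; raising it to the
    -- power `(q-1)s` gives `z^(-s)`, so `b_k = 1` suffices.
    refine ⟨fun r => studentConst (q - 1) C d k * r ^ ((q - 1) * studentExponent d k),
      fun _ => 1, fun r hr => mul_pos hK (Real.rpow_pos_of_pos hr _), fun r hr r' _ hrr' => ?_,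
      contDiffOn_const.mul (contDiffOn_rpow_Ioi _), fun _ => one_pos, contMDiff_const,
      fun θ T c ψ h => ?_⟩
    · exact mul_lt_mul_of_pos_left (Real.rpow_lt_rpow (le_of_lt hr) hrr' (mul_pos h1 hs)) hK
    -- The sum contains the constant `(C-1)/(q-1)` with a minus sign `k` times, while `ℓ` of the
    -- target contains it once; the second term of `ψ_k` makes up for the difference.
    · refine ⟨fun p => k * ψ p + (1 - k) * ((C - 1) / (q - 1)), ?_, fun p x => ?_⟩
      · have hψ : ContMDiff (𝓡 d) 𝓘(ℝ, ℝ) ∞ ψ := by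
          rw [← contMDiffOn_univ, ← h.source_eq]
          exact h.smooth_psi
        exact ((contDiff_const.mul contDiff_id).add contDiff_const : ContDiff ℝ ∞ fun t : ℝ =>
          k * t + (1 - k) * ((C - 1) / (q - 1))).contMDiff.comp hψ
      · set Q := ∑ m, ‖x m - φ p‖ ^ 2 with hQ
        have hz : 0 < C + (q - 1) * Q := by positivity
        have hr := Real.rpow_pos_of_pos hz (1 / (1 - q))
        refine ⟨(C + (q - 1) * Q) ^ (1 / (1 - q)), hr, ?_, ?_⟩
        · rw [← deformedExp_ell hq1.ne' hr, ell_hq_rpow hq1.ne' hz]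
          congr 1
          simp_rw [h.inner_sub_eq hq1 hdq he p]
          rw [Finset.sum_sub_distrib, ← hQ, Finset.sum_const, Finset.card_univ, Fintype.card_fin,
            nsmul_eq_mul, ← hCdef]
          have h2 : 1 - q ≠ 0 := by linarith
          field_simp
          ring
        · have h2 : 1 - q ≠ 0 := by linarith
          simp only
          rw [studentDensity_eq, ← Real.rpow_mul hz.le,
            show 1 / (1 - q) * ((q - 1) * studentExponent d k) = -studentExponent d k by
              field_simp
              ring]
  marginal k k' _ _ p x := integral_studentDensity_append (by linarith)
    (qGaussianConst_pos hq1 hdq) k k' _ x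

theorem integrable_student_smul (hq1 : 1 < q) (hdq : (d : ℝ) * (q - 1) < 2)
    (he : ∀ p, e p = qGaussian q d (φ p)) {θ : OpenPartialHomeomorph M (EuclideanSpace ℝ (Fin d))}
    {T : EuclideanSpace ℝ (Fin d) → EuclideanSpace ℝ (Fin d)} {c : EuclideanSpace ℝ (Fin d) → ℝ}
    {ψ : M → ℝ} (h : IsGlobalExpCoordRep (n := d) (hq q) id (Set.Ioi 0) e θ T c ψ)
    (v : EuclideanSpace ℝ (Fin d)) :
    Integrable fun x => studentDensity (q - 1) (qGaussianConst q d) 1 v (fun _ => x) • T x := by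
  refine Integrable.of_eval_piLp fun i => ?_
  obtain ⟨w, b, hw⟩ := h.exists_inner_eq hq1 hdq he (EuclideanSpace.single i 1)
  have := integrable_studentDensity_one_mul (by linarith : 0 < q - 1)
    (qGaussianConst_pos hq1 hdq) v w b
  refine this.congr (Eventually.of_forall fun x => ?_)
  have h2 := hw x
  rw [EuclideanSpace.inner_single_left] at h2
  simp only [map_one, one_mul] at h2
  simp [h2]

end Repetition

/-! ### The strong law of large numbers for repetitions of `q`-Gaussians -/

theorem map_withDensity_of_involutive {α : Type*} [MeasurableSpace α] {μ : Measure α} {σ : α → α}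
    (hσ : MeasurePreserving σ μ μ) (hinv : Function.Involutive σ) {f : α → ENNReal}
    (hf : ∀ x, f (σ x) = f x) : (μ.withDensity f).map σ = μ.withDensity f := by
  let e : α ≃ᵐ α := ⟨hinv.toPerm, hσ.measurable, hσ.measurable⟩
  ext s hs
  rw [Measure.map_apply hσ.measurable hs, withDensity_apply _ (hσ.measurable hs),
    withDensity_apply _ hs, ← hσ.setLIntegral_comp_preimage_emb e.measurableEmbedding]
  simp_rw [hf]
  rw [← Set.preimage_comp, hinv.comp_self, Set.preimage_id]

theorem measurePreserving_swap {E : Type*} [MeasurableSpace E] (μ : Measure E) [SigmaFinite μ]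
    {k : ℕ} (i j : Fin k) :
    MeasurePreserving (fun (x : Fin k → E) m => x (Equiv.swap i j m)) (prodMeasure μ k)
      (prodMeasure μ k) := by
  have h := measurePreserving_piCongrLeft (fun _ : Fin k => μ) (Equiv.swap i j)
  convert h using 1
  ext x m
  obtain ⟨m', rfl⟩ := (Equiv.swap i j).surjective m
  rw [MeasurableEquiv.coe_piCongrLeft, Equiv.piCongrLeft_apply_apply]
  simp

theorem measurePreserving_reflect_last {E : Type*} [NormedAddCommGroup E] [NormedSpace ℝ E]
    [FiniteDimensional ℝ E] [MeasurableSpace E] [BorelSpace E] (μ : Measure E) [μ.IsAddHaarMeasure]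
    (n : ℕ) (a : E) :
    MeasurePreserving (fun (x : Fin (n + 1) → E) m => if m = Fin.last n then a - x m else x m)
      (prodMeasure μ (n + 1)) (prodMeasure μ (n + 1)) := by
  have h := measurePreserving_pi (fun _ : Fin (n + 1) => μ) (fun _ => μ)
    (f := fun m => if m = Fin.last n then fun x => a - x else id) fun m => by
      by_cases hm : m = Fin.last n
      · simpa [hm] using μ.measurePreserving_sub_left a
      · simpa [hm] using MeasurePreserving.id μ
  convert h using 1
  ext x m
  by_cases hm : m = Fin.last n <;> simp [hm]

section StrongLawRepetition

variable {d : ℕ} {q : ℝ} {M : Type*} [TopologicalSpace M]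
  [ChartedSpace (EuclideanSpace ℝ (Fin d)) M] {φ : M ≃ₜ EuclideanSpace ℝ (Fin d)}
  {e : M → EuclideanSpace ℝ (Fin d) → ℝ}
  {θ : OpenPartialHomeomorph M (EuclideanSpace ℝ (Fin d))}
  {T : EuclideanSpace ℝ (Fin d) → EuclideanSpace ℝ (Fin d)} {c : EuclideanSpace ℝ (Fin d) → ℝ}
  {ψ : M → ℝ} {ι : ∀ k : ℕ, M → (Fin k → EuclideanSpace ℝ (Fin d)) → ℝ}

/-- Any repetition of the family of `q`-Gaussians consists of densities that depend only on the
distance from the location. -/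
theorem IsRepetition.eq_of_sum_norm_sq_eq (hq1 : 1 < q) (hdq : (d : ℝ) * (q - 1) < 2)
    (he : ∀ p, e p = qGaussian q d (φ p))
    (hι : IsRepetition (n := d) (hq q) id (Set.Ioi 0) volume e ι)
    (h : IsGlobalExpCoordRep (n := d) (hq q) id (Set.Ioi 0) e θ T c ψ) {k : ℕ} (hk : 1 ≤ k) (p : M)
    {x x' : Fin k → EuclideanSpace ℝ (Fin d)}
    (hx : ∑ m, ‖x m - φ p‖ ^ 2 = ∑ m, ‖x' m - φ p‖ ^ 2) : ι k p x = ι k p x' := by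
  obtain ⟨α, b, -, -, -, -, -, hform⟩ := hι.formula k hk
  obtain ⟨ψk, -, hψk⟩ := hform θ T c ψ h
  obtain ⟨r, -, hr, hrx⟩ := hψk p x
  obtain ⟨r', -, hr', hrx'⟩ := hψk p x'
  -- The unknown `b_k` and `ψ_k` depend on `p` only, so the argument of the deformed exponential
  -- sees `x` only through the sum of squares.
  simp_rw [h.inner_sub_eq hq1 hdq he p, Finset.sum_sub_distrib] at hr hr'
  rw [hx, ← hr'] at hr
  rw [hrx, hrx', EReal.coe_injective hr]

/-- Substituting `2v - x` for `x` preserves the density and turns `T` into `2T(v) - T`; the mean `m`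
therefore satisfies `m = 2T(v) - m`. -/
theorem integral_one_smul_eq (hq1 : 1 < q) (hdq : (d : ℝ) * (q - 1) < 2)
    (he : ∀ p, e p = qGaussian q d (φ p))
    (hι : IsRepetition (n := d) (hq q) id (Set.Ioi 0) volume e ι)
    (h : IsGlobalExpCoordRep (n := d) (hq q) id (Set.Ioi 0) e θ T c ψ) (p : M)
    (hT : Integrable (fun x => ι 1 p (fun _ => x) • T x) volume) :
    ∫ x, ι 1 p (fun _ => x) • T x = T (φ p) := by
  set v := φ p
  have hmp := measurePreserving_funUnique (volume : Measure (EuclideanSpace ℝ (Fin d))) (Fin 1)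
  have hcomp : (fun x => ι 1 p (fun _ => x)) ∘
      MeasurableEquiv.funUnique (Fin 1) (EuclideanSpace ℝ (Fin d)) = ι 1 p := by
    ext y
    simp only [Function.comp_apply, MeasurableEquiv.funUnique_apply]
    congr 1
    ext1 m
    rw [Subsingleton.elim m default]
  have hi : Integrable fun x => ι 1 p (fun _ => x) := by
    rw [← hmp.integrable_comp_emb (MeasurableEquiv.measurableEmbedding _), hcomp]
    exact (hι.density 1 le_rfl p).integrable
  have h1 : ∫ x, ι 1 p (fun _ => x) = 1 := by
    rw [← hmp.integral_comp (MeasurableEquiv.measurableEmbedding _), ← (hι.density 1 le_rfl p).integral_eq_one]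
    exact congrArg (fun f => ∫ y, f y ∂(prodMeasure volume 1)) hcomp
  have h2 : ∀ x, ι 1 p (fun _ => v + v - x) = ι 1 p (fun _ => x) := by
    intro x
    refine hι.eq_of_sum_norm_sq_eq hq1 hdq he h le_rfl p ?_
    rw [Fin.sum_univ_one, Fin.sum_univ_one, show v + v - x - φ p = -(x - φ p) by
      simp only [v]; abel, norm_neg]
  have h3 := integral_sub_left_eq_self (fun x => ι 1 p (fun _ => x) • T x) volume (v + v)
  simp_rw [h2, h.reflect hq1 hdq he, smul_sub] at h3
  rw [integral_sub (hi.smul_const _) hT, integral_smul_const, h1, one_smul, sub_eq_iff_eq_add,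
    ← two_smul ℝ, ← two_smul ℝ] at h3
  exact (smul_right_injective _ (two_ne_zero' ℝ) h3).symm

variable {Ω : Type*} [MeasurableSpace Ω] {P : Measure Ω}
  {Y : ℕ → Ω → EuclideanSpace ℝ (Fin d)} {p : M}

omit [TopologicalSpace M] [ChartedSpace (EuclideanSpace ℝ (Fin d)) M] in
theorem IsDependentIdent.identDistrib_comp (hY : IsDependentIdent volume ι p P Y) {k : ℕ}
    (hk : 1 ≤ k) {σ : (Fin k → EuclideanSpace ℝ (Fin d)) → Fin k → EuclideanSpace ℝ (Fin d)}
    (hσ : MeasurePreserving σ (prodMeasure volume k) (prodMeasure volume k))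
    (hinv : Function.Involutive σ) (hf : ∀ x, ι k p (σ x) = ι k p x) :
    ProbabilityTheory.IdentDistrib (fun w (m : Fin k) => Y m w)
      (fun w => σ fun m : Fin k => Y m w) P P := by
  have hm : Measurable fun w (m : Fin k) => Y m w :=
    measurable_pi_lambda _ fun m => hY.measurable m
  refine ⟨hm.aemeasurable, (hσ.measurable.comp hm).aemeasurable, ?_⟩
  have h1 : P.map (fun w => σ fun m : Fin k => Y m w) =
      (P.map fun w (m : Fin k) => Y m w).map σ := (Measure.map_map hσ.measurable hm).symm
  rw [h1, hY.law k hk, map_withDensity_of_involutive hσ hinv fun x => by rw [hf]]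

theorem integrable_comp_of_isDependentIdent
    (hι : IsRepetition (n := d) (hq q) id (Set.Ioi 0) volume e ι)
    (hY : IsDependentIdent volume ι p P Y) (hTm : Continuous T)
    (hT : Integrable (fun x => ι 1 p (fun _ => x) • T x) volume) :
    Integrable (fun w => T (Y 0 w)) P := by
  have hm : Measurable fun w (m : Fin 1) => Y m w := measurable_pi_lambda _ fun m => hY.measurable m
  have hd := hι.density 1 le_rfl p
  have hTm1 : StronglyMeasurable fun y : Fin 1 → EuclideanSpace ℝ (Fin d) => T (y 0) :=
    (hTm.comp (continuous_apply 0)).stronglyMeasurable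
  have h1 : Integrable (fun y : Fin 1 → EuclideanSpace ℝ (Fin d) => T (y 0))
      (P.map fun w (m : Fin 1) => Y m w) := by
    rw [hY.law 1 le_rfl]
    change Integrable _ ((prodMeasure volume 1).withDensity
      fun x => ((ι 1 p x).toNNReal : ENNReal))
    rw [integrable_withDensity_iff_integrable_smul₀
      hd.integrable.aestronglyMeasurable.aemeasurable.real_toNNReal]
    have hmp := measurePreserving_funUnique (volume : Measure (EuclideanSpace ℝ (Fin d))) (Fin 1)
    refine ((hmp.integrable_comp_emb (MeasurableEquiv.measurableEmbedding _)).2 hT).congr ?_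
    filter_upwards [hd.mem] with y hy
    have hy0 : (fun _ : Fin 1 => y 0) = y := by
      ext1 m
      rw [Subsingleton.elim m 0]
    simp only [Function.comp_apply, MeasurableEquiv.funUnique_apply, Fin.default_eq_zero,
      NNReal.smul_def, Real.coe_toNNReal _ (le_of_lt hy)]
    rw [hy0]
  exact (integrable_map_measure hTm1.aestronglyMeasurable hm.aemeasurable).1 h1

theorem strong_law_qGaussian [IsProbabilityMeasure P] (hq1 : 1 < q) (hdq : (d : ℝ) * (q - 1) < 2)
    (he : ∀ p, e p = qGaussian q d (φ p))
    (hι : IsRepetition (n := d) (hq q) id (Set.Ioi 0) volume e ι)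
    (h : IsGlobalExpCoordRep (n := d) (hq q) id (Set.Ioi 0) e θ T c ψ)
    (hT : Integrable (fun x => ι 1 p (fun _ => x) • T x) volume)
    (hY : IsDependentIdent volume ι p P Y) :
    ∀ᵐ w ∂P, Tendsto (fun k : ℕ => (k : ℝ)⁻¹ • ∑ m ∈ Finset.range k, T (Y m w)) atTop
      (𝓝 (∫ x, ι 1 p (fun _ => x) • T x)) := by
  rw [integral_one_smul_eq hq1 hdq he hι h p hT]
  set v := φ p with hv
  have hTc := h.continuous_T
  have hcoord : ∀ i : Fin d, ∀ᵐ w ∂P, Tendsto (fun k : ℕ => (k : ℝ)⁻¹ *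
      ∑ m ∈ Finset.range k, (T (Y m w) i - T v i)) atTop (𝓝 0) := by
    intro i
    have hg : Continuous fun x => T x i - T v i := by fun_prop
    refine strong_law_of_reflection (ξ := fun m w => T (Y m w) i - T v i)
      (fun n => hg.measurable.comp (hY.measurable n)) ?_ (fun n => ?_) fun n => ?_
    · exact ((integrable_comp_of_isDependentIdent hι hY hTc hT).eval_piLp i).sub
        (integrable_const _)
    -- Swapping the first and the last variable shows that they have the same law.
    · have h1 := hY.identDistrib_comp (k := n + 1) (by omega)
        (measurePreserving_swap volume 0 (Fin.last n)) (fun x => by ext1 m; simp) fun x => by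
          refine hι.eq_of_sum_norm_sq_eq hq1 hdq he h (by omega) p ?_
          exact Equiv.sum_comp (Equiv.swap 0 (Fin.last n)) fun m => ‖x m - φ p‖ ^ 2
      have h2 := h1.comp (u := fun y : Fin (n + 1) → EuclideanSpace ℝ (Fin d) =>
        T (y (Fin.last n)) i - T v i)
        (hg.measurable.comp (measurable_pi_apply (Fin.last n)))
      simpa [Function.comp_def] using h2
    -- Reflecting the last variable in `v` changes the sign of the last centred coordinate, since
    -- `T` is affine.
    · have h1 := hY.identDistrib_comp (k := n + 1) (by omega)
        (measurePreserving_reflect_last volume n (v + v))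
        (fun x => by ext1 m; by_cases hm : m = Fin.last n <;> simp [hm]) fun x => by
          refine hι.eq_of_sum_norm_sq_eq hq1 hdq he h (by omega) p ?_
          refine Finset.sum_congr rfl fun m _ => ?_
          by_cases hm : m = Fin.last n
          · rw [if_pos hm, ← norm_neg, hv]
            congr 2
            abel
          · rw [if_neg hm]
      have h2 := h1.comp (u := fun (y : Fin (n + 1) → EuclideanSpace ℝ (Fin d)) m =>
        T (y m) i - T v i) (measurable_pi_lambda _ fun m =>
          hg.measurable.comp (measurable_pi_apply m))
      convert h2 using 1
      · rfl
      · ext w m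
        by_cases hm : m = Fin.last n
        · simp only [hm, if_true, Function.comp_apply, h.reflect hq1 hdq he, PiLp.sub_apply,
            PiLp.add_apply]
          ring
        · simp [hm]
  filter_upwards [ae_all_iff.2 hcoord] with w hw
  have hpi : Tendsto (fun (k : ℕ) (i : Fin d) => ((k : ℝ)⁻¹ • ∑ m ∈ Finset.range k, T (Y m w)) i)
      atTop (𝓝 fun i => T v i) := by
    rw [tendsto_pi_nhds]
    intro i
    have h1 := (hw i).add_const (T v i)
    rw [zero_add] at h1
    refine h1.congr' ?_
    filter_upwards [eventually_ne_atTop 0] with k hk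
    have hk' : (k : ℝ) ≠ 0 := Nat.cast_ne_zero.2 hk
    rw [Finset.sum_sub_distrib, Finset.sum_const, Finset.card_range, nsmul_eq_mul, mul_sub,
      inv_mul_cancel_left₀ hk', sub_add_cancel]
    simp
  exact ((PiLp.continuous_toLp 2 fun _ : Fin d => ℝ).tendsto _).comp hpi

end StrongLawRepetition

/-- The bijection between the `q`-Gaussians and their locations. -/
noncomputable def qGaussianEquiv {d : ℕ} {q : ℝ} (hq1 : 1 < q) (hdq : (d : ℝ) * (q - 1) < 2) :
    ↥(qGaussianFamily q d) ≃ EuclideanSpace ℝ (Fin d) :=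
  (Equiv.ofBijective (fun v => (⟨qGaussian q d v, v, rfl⟩ : ↥(qGaussianFamily q d)))
    ⟨fun _ _ h => qGaussian_injective hq1 hdq (Subtype.ext_iff.1 h),
      fun ⟨_, v, hv⟩ => ⟨v, Subtype.ext hv.symm⟩⟩).symm

theorem densityOf_qGaussianFamily {d : ℕ} {q : ℝ} (hq1 : 1 < q) (hdq : (d : ℝ) * (q - 1) < 2)
    (p : ↥(qGaussianFamily q d)) :
    densityOf (qGaussianFamily q d) p = qGaussian q d (qGaussianEquiv hq1 hdq p) := by
  obtain ⟨v, rfl⟩ := (qGaussianEquiv hq1 hdq).symm.surjective p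
  rw [Equiv.apply_symm_apply]
  rfl

end DeformedExp

theorem theorem1p3 (d : ℕ) (hd : 1 ≤ d) (q : ℝ) (hq1 : 1 < q) (hdq : (d : ℝ) * (q - 1) < 2) :
    ∃ (_ : TopologicalSpace ↥(qGaussianFamily q d))
      (_ : ChartedSpace (EuclideanSpace ℝ (Fin d)) ↥(qGaussianFamily q d))
      (_ : IsManifold (𝓡 d) ∞ ↥(qGaussianFamily q d)),
      -- the set of `q`-Gaussians is an exponential family with a global representation
      IsExpFamily (hq q) id (Set.Ioi 0) volume d (densityOf (qGaussianFamily q d)) ∧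
      (∃ θ T c ψ,
        IsGlobalExpCoordRep (n := d) (hq q) id (Set.Ioi 0) (densityOf (qGaussianFamily q d))
          θ T c ψ) ∧
      -- it is identically repeatable, by a repetition for which `T` has a finite mean
      (∃ ι, IsRepetition (n := d) (hq q) id (Set.Ioi 0) volume
          (densityOf (qGaussianFamily q d)) ι ∧
        ∀ θ T c ψ,
          IsGlobalExpCoordRep (n := d) (hq q) id (Set.Ioi 0) (densityOf (qGaussianFamily q d))
            θ T c ψ →
          ∀ p, Integrable (fun x => ι 1 p (fun _ => x) • T x) volume) ∧
      -- the strong law of large numbers, for every repetition for which `T` has a finite mean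
      (∀ ι, IsRepetition (n := d) (hq q) id (Set.Ioi 0) volume
          (densityOf (qGaussianFamily q d)) ι →
        ∀ θ T c ψ,
          IsGlobalExpCoordRep (n := d) (hq q) id (Set.Ioi 0) (densityOf (qGaussianFamily q d))
            θ T c ψ →
          ∀ p, Integrable (fun x => ι 1 p (fun _ => x) • T x) volume →
            ∀ (Ω : Type*) [MeasurableSpace Ω] (P : Measure Ω) [IsProbabilityMeasure P]
              (Y : ℕ → Ω → EuclideanSpace ℝ (Fin d)),
              IsDependentIdent volume ι p P Y →
                ∀ᵐ w ∂P, Tendsto (fun k : ℕ => (k : ℝ)⁻¹ • ∑ m ∈ Finset.range k, T (Y m w))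
                  atTop (𝓝 (∫ x, ι 1 p (fun _ => x) • T x))) := by
  obtain ⟨t, ch, hman, φ, hφ, hchart⟩ := exists_globalChart (qGaussianEquiv hq1 hdq)
  have he : ∀ p, densityOf (qGaussianFamily q d) p = qGaussian q d (φ p) := fun p => by
    rw [hφ, densityOf_qGaussianFamily hq1 hdq]
  refine ⟨t, ch, hman, isExpFamily_qGaussian hchart hq1 hdq he,
    exists_isGlobalExpCoordRep_qGaussian hchart hq1 hdq he,
    ⟨_, isRepetition_student hq1 hdq he, fun θ T c ψ h p =>
      integrable_student_smul hq1 hdq he h (φ p)⟩, ?_⟩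
  intro ι hι θ T c ψ h p hT Ω _ P _ Y hY
  exact strong_law_qGaussian hq1 hdq he hι h hT hY
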